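/- Let $\mathbb{B}^2=\{z\in\mathbb{C}^2 : |z|^2=|z_1|^2+|z_2|^2<1\}$ and let $\mathrm{SU}(2,1)$ be the group of matrices of determinant $1$ preserving the Hermitian form $\langle u,v\rangle=u_1\overline{v_1}+u_2\overline{v_2}-u_3\overline{v_3}$ on $\mathbb{C}^3$, acting on $\mathbb{B}^2$ by fractional linear transformations. Let $\Gamma\subset\mathrm{SU}(2,1)$ be a discrete, torsion-free, cocompact subgroup, and let $X_\Gamma=\Gamma\backslash\mathbb{B}^2$ be the associated compact Picard surface. Equip $\mathbb{B}^2$ and $X_\Gamma$ with the hyperbolic metric $-\tfrac{i}{2}\partial\overline\partial\log(1-|z|^2)$, and with its volume form $\mu^{\mathrm{vol}}_{\mathrm{hyp}}(z)=(i/2)^2(1-|z|^2)^{-3}\,dz_1\wedge d\overline{z_1}\wedge dz_2\wedge d\overline{z_2}$. Let the hyperbolic distance on $\mathbb{B}^2$ be normalized by $$\cosh^2\big(d_{\mathrm{hyp}}(z,w)/2\big)=\frac{|\langle\tilde z,\tilde w\rangle|^2}{\langle\tilde z,\tilde z\rangle\langle\tilde w,\tilde w\rangle},\qquad \tilde z=(z_1,z_2,1),\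 \tilde w=(w_1,w_2,1),$$ and for $z,w\in X_\Gamma$ let $d_{\mathrm{hyp}}(z,w)$ be the geodesic distance on $X_\Gamma$, that is, the least distance between lifts of $z$ and $w$ to $\mathbb{B}^2$. Let $\Lambda=\Omega^2_{X_\Gamma}$ be the line bundle of holomorphic $(2,0)$-forms. For $k\ge 1$ the hyperbolic metric induces a point-wise metric $|\cdot|_{\mathrm{hyp}}$ on $\Lambda^{\otimes k}$, given on the ball by $|f(z)(dz_1\wedge dz_2)^{\otimes k}|_{\mathrm{hyp}}^2=(1-|z|^2)^{3k}|f(z)|^2$, and, by integration against $\mu^{\mathrm{vol}}_{\mathrm{hyp}}$, an $L^2$ inner product on $H^0(X_\Gamma,\Lambda^{\otimes k})$. Let $\omega_1,\dots,\omega_{d_k}$ be an orthonormal basis of $H^0(X_\Gamma,\Lambda^{\otimes k})$, and let $\mathcal{B}^k_\Lambda(z,w)=\sum_{j=1}^{d_k}\omega_j(z)\overline{\omega_j(w)}$ be the Bergman kernel. If $\omega_j=f_j\,(dz_1\wedge dz_2)^{\otimes k}$ on the ball, its point-wise norm is $|\mathcal{B}^k_\Lambda(z,w)|_{\mathrm{hyp}}=(1-|z|^2)^{3k/2}(1-|w|^2)^{3k/2}\big|\sum_j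 f_j(z)\overline{f_j(w)}\big|$. Then there is a constant $C$, depending only on $X_\Gamma$, such that for all $k\ge 3$ and all $z,w\in X_\Gamma$, $$\big|\mathcal{B}^k_\Lambda(z,w)\big|_{\mathrm{hyp}}\le C\,\frac{k^2}{\cosh^{3k-8}\big(d_{\mathrm{hyp}}(z,w)/2\big)}.$$ -/

import Mathlib

noncomputable section

/-! # The complex ball, the group SU(2,1), and its action -/

/-- Matrix of the standard Hermitian form of signature (2,1) on `ℂ³`. -/
def formH : Matrix (Fin 3) (Fin 3) ℂ := Matrix.diagonal ![1, 1, -1]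

/-- The group `SU((2,1), ℂ)`, as a subgroup of `SL(3, ℂ)`. -/
def SU21 : Subgroup (Matrix.SpecialLinearGroup (Fin 3) ℂ) where
  carrier := {A | (A : Matrix (Fin 3) (Fin 3) ℂ).conjTranspose * formH * A = formH}
  one_mem' := by simp
  mul_mem' := by
    intro A B hA hB
    simp only [Set.mem_ofPred_eq, Matrix.SpecialLinearGroup.coe_mul,
      Matrix.conjTranspose_mul] at hA hB ⊢
    calc (B : Matrix (Fin 3) (Fin 3) ℂ).conjTranspose *
          (A : Matrix (Fin 3) (Fin 3) ℂ).conjTranspose * formH * (↑A * ↑B)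
        = (B : Matrix (Fin 3) (Fin 3) ℂ).conjTranspose *
          ((A : Matrix (Fin 3) (Fin 3) ℂ).conjTranspose * formH * ↑A) * ↑B := by
          simp only [Matrix.mul_assoc]
      _ = formH := by rw [hA, hB]
  inv_mem' := by
    intro A hA
    simp only [Set.mem_ofPred_eq] at hA ⊢
    have h1 : (A : Matrix (Fin 3) (Fin 3) ℂ) *
        ((A⁻¹ : Matrix.SpecialLinearGroup (Fin 3) ℂ) : Matrix (Fin 3) (Fin 3) ℂ) = 1 := by
      rw [← Matrix.SpecialLinearGroup.coe_mul, mul_inv_cancel, Matrix.SpecialLinearGroup.coe_one]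
    have h2 : ((A⁻¹ : Matrix.SpecialLinearGroup (Fin 3) ℂ) :
        Matrix (Fin 3) (Fin 3) ℂ).conjTranspose *
        (A : Matrix (Fin 3) (Fin 3) ℂ).conjTranspose = 1 := by
      rw [← Matrix.conjTranspose_mul, h1, Matrix.conjTranspose_one]
    calc ((A⁻¹ : Matrix.SpecialLinearGroup (Fin 3) ℂ) :
          Matrix (Fin 3) (Fin 3) ℂ).conjTranspose * formH *
          ((A⁻¹ : Matrix.SpecialLinearGroup (Fin 3) ℂ) : Matrix (Fin 3) (Fin 3) ℂ)
        = ((A⁻¹ : Matrix.SpecialLinearGroup (Fin 3) ℂ) :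
          Matrix (Fin 3) (Fin 3) ℂ).conjTranspose *
          ((A : Matrix (Fin 3) (Fin 3) ℂ).conjTranspose * formH * ↑A) *
          ((A⁻¹ : Matrix.SpecialLinearGroup (Fin 3) ℂ) : Matrix (Fin 3) (Fin 3) ℂ) := by
          rw [hA]
      _ = (((A⁻¹ : Matrix.SpecialLinearGroup (Fin 3) ℂ) :
          Matrix (Fin 3) (Fin 3) ℂ).conjTranspose *
          (A : Matrix (Fin 3) (Fin 3) ℂ).conjTranspose) * formH * (↑A *
          ((A⁻¹ : Matrix.SpecialLinearGroup (Fin 3) ℂ) : Matrix (Fin 3) (Fin 3) ℂ)) := by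
          simp only [Matrix.mul_assoc]
      _ = formH := by rw [h1, h2]; simp

/-- The squared Euclidean norm `|z|² = |z₁|² + |z₂|²` on `ℂ²`. -/
def normSq2 (z : Fin 2 → ℂ) : ℝ := ‖z 0‖ ^ 2 + ‖z 1‖ ^ 2

/-- The open unit ball `𝔹²` of `ℂ²`, as a set. -/
def ballSet : Set (Fin 2 → ℂ) := {z | normSq2 z < 1}

/-- The open unit ball `𝔹²` of `ℂ²`, as a space. -/
abbrev Ball2 : Type := {z : Fin 2 → ℂ // z ∈ ballSet}

/-- The lift `(z₁, z₂, 1)` of a point of `ℂ²` to `ℂ³`. -/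
def lift3 (z : Fin 2 → ℂ) : Fin 3 → ℂ := ![z 0, z 1, 1]

/-- The Hermitian form `⟨u, v⟩ = v* H u` of signature (2,1) on `ℂ³`. -/
def herm (u v : Fin 3 → ℂ) : ℂ := star v ⬝ᵥ (formH.mulVec u)

/-- The fractional linear map `z ↦ (A z + B) / (C z + D)` of the matrix with blocks
`A, B, C, D` (a total function, meaningful where `C z + D ≠ 0`). -/
def fracLin (γ : Matrix (Fin 3) (Fin 3) ℂ) (z : Fin 2 → ℂ) : Fin 2 → ℂ :=
  fun i => γ.mulVec (lift3 z) i.castSucc / γ.mulVec (lift3 z) 2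

theorem herm_apply (u v : Fin 3 → ℂ) :
    herm u v = u 0 * star (v 0) + u 1 * star (v 1) - u 2 * star (v 2) := by
  simp [herm, formH, Matrix.mulVec_diagonal, dotProduct, Fin.sum_univ_three]
  ring

theorem herm_self (u : Fin 3 → ℂ) :
    herm u u = ((‖u 0‖ ^ 2 + ‖u 1‖ ^ 2 - ‖u 2‖ ^ 2 : ℝ) : ℂ) := by
  rw [herm_apply]
  simp only [Complex.star_def, Complex.mul_conj, Complex.normSq_eq_norm_sq]
  push_cast
  ring

theorem herm_mulVec {γ : Matrix.SpecialLinearGroup (Fin 3) ℂ} (hγ : γ ∈ SU21)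
    (u v : Fin 3 → ℂ) :
    herm ((γ : Matrix (Fin 3) (Fin 3) ℂ).mulVec u)
      ((γ : Matrix (Fin 3) (Fin 3) ℂ).mulVec v) = herm u v := by
  have h : (γ : Matrix (Fin 3) (Fin 3) ℂ).conjTranspose * formH * γ = formH := hγ
  unfold herm
  rw [Matrix.star_mulVec, ← Matrix.dotProduct_mulVec, Matrix.mulVec_mulVec, Matrix.mulVec_mulVec, h]

theorem norm_mulVec_lift3 {γ : Matrix.SpecialLinearGroup (Fin 3) ℂ} (hγ : γ ∈ SU21)
    (z : Fin 2 → ℂ) :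
    ‖(γ : Matrix (Fin 3) (Fin 3) ℂ).mulVec (lift3 z) 0‖ ^ 2 +
      ‖(γ : Matrix (Fin 3) (Fin 3) ℂ).mulVec (lift3 z) 1‖ ^ 2 -
      ‖(γ : Matrix (Fin 3) (Fin 3) ℂ).mulVec (lift3 z) 2‖ ^ 2 = normSq2 z - 1 := by
  have h := herm_mulVec hγ (lift3 z) (lift3 z)
  rw [herm_self, herm_self] at h
  have h' := Complex.ofReal_injective h
  simpa [lift3, normSq2] using h'

theorem denom_ne_zero {γ : Matrix.SpecialLinearGroup (Fin 3) ℂ} (hγ : γ ∈ SU21)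
    {z : Fin 2 → ℂ} (hz : z ∈ ballSet) :
    (γ : Matrix (Fin 3) (Fin 3) ℂ).mulVec (lift3 z) 2 ≠ 0 := by
  intro h0
  have h := norm_mulVec_lift3 hγ z
  have hz' : normSq2 z < 1 := hz
  rw [h0, norm_zero] at h
  nlinarith [sq_nonneg ‖(γ : Matrix (Fin 3) (Fin 3) ℂ).mulVec (lift3 z) 0‖,
    sq_nonneg ‖(γ : Matrix (Fin 3) (Fin 3) ℂ).mulVec (lift3 z) 1‖]

theorem fracLin_mem {γ : Matrix.SpecialLinearGroup (Fin 3) ℂ} (hγ : γ ∈ SU21)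
    {z : Fin 2 → ℂ} (hz : z ∈ ballSet) :
    fracLin (γ : Matrix (Fin 3) (Fin 3) ℂ) z ∈ ballSet := by
  have hd := denom_ne_zero hγ hz
  have hpos : 0 < ‖(γ : Matrix (Fin 3) (Fin 3) ℂ).mulVec (lift3 z) 2‖ := norm_pos_iff.mpr hd
  have h := norm_mulVec_lift3 hγ z
  have hz' : normSq2 z < 1 := hz
  change ‖_ / _‖ ^ 2 + ‖_ / _‖ ^ 2 < (1 : ℝ)
  rw [norm_div, norm_div, div_pow, div_pow, ← add_div, div_lt_one (by positivity)]
  change ‖(γ : Matrix (Fin 3) (Fin 3) ℂ).mulVec (lift3 z) 0‖ ^ 2 +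
      ‖(γ : Matrix (Fin 3) (Fin 3) ℂ).mulVec (lift3 z) 1‖ ^ 2 < _
  linarith

theorem smul_lift3_fracLin {γ : Matrix (Fin 3) (Fin 3) ℂ} {z : Fin 2 → ℂ}
    (hd : γ.mulVec (lift3 z) 2 ≠ 0) :
    γ.mulVec (lift3 z) 2 • lift3 (fracLin γ z) = γ.mulVec (lift3 z) := by
  funext i
  fin_cases i
  · exact mul_div_cancel₀ _ hd
  · exact mul_div_cancel₀ _ hd
  · exact mul_one _

/-- The action of `SU((2,1), ℂ)` on the ball by fractional linear transformations. -/
instance : MulAction SU21 Ball2 where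
  smul γ z := ⟨fracLin (γ : Matrix.SpecialLinearGroup (Fin 3) ℂ) z.1, fracLin_mem γ.2 z.2⟩
  one_smul z := by
    apply Subtype.ext
    funext i
    change fracLin _ _ i = _
    fin_cases i <;> simp [fracLin, lift3]
  mul_smul γ δ z := by
    apply Subtype.ext
    change fracLin ((γ * δ : SU21) : Matrix.SpecialLinearGroup (Fin 3) ℂ) z.1 =
      fracLin (γ : Matrix.SpecialLinearGroup (Fin 3) ℂ)
        (fracLin (δ : Matrix.SpecialLinearGroup (Fin 3) ℂ) z.1)
    have hd := denom_ne_zero δ.2 z.2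
    have h := smul_lift3_fracLin hd
    have h2 : ((γ * δ : SU21) : Matrix.SpecialLinearGroup (Fin 3) ℂ).1.mulVec (lift3 z.1) =
        (δ : Matrix.SpecialLinearGroup (Fin 3) ℂ).1.mulVec (lift3 z.1) 2 •
        (γ : Matrix.SpecialLinearGroup (Fin 3) ℂ).1.mulVec
          (lift3 (fracLin (δ : Matrix.SpecialLinearGroup (Fin 3) ℂ) z.1)) := by
      rw [← Matrix.mulVec_smul, h, Matrix.mulVec_mulVec]
      rfl
    funext i
    unfold fracLin at h2 ⊢
    rw [h2]
    simp only [Pi.smul_apply, smul_eq_mul]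
    rw [mul_div_mul_left _ _ hd]

/-! # The hyperbolic metric, volume and distance on the ball -/

/-- The Hermitian matrix `g_{ij} = -∂_i ∂̄_j log (1 - |z|²)` of the hyperbolic metric
`-(i/2) ∂∂̄ log (1 - |z|²) = (i/2) ∑ g_{ij} dz_i ∧ dz̄_j` at `z`. -/
def hypMetric (z : Ball2) : Matrix (Fin 2) (Fin 2) ℂ :=
  Matrix.of fun i j =>
    (if i = j then 1 / (1 - (normSq2 z.1 : ℂ)) else 0) +
      star (z.1 i) * z.1 j / (1 - (normSq2 z.1 : ℂ)) ^ 2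

theorem one_sub_normSq2_pos (z : Ball2) : 0 < 1 - normSq2 z.1 := sub_pos.mpr z.2

theorem hypMetric_det (z : Ball2) :
    (hypMetric z).det = ((1 / (1 - normSq2 z.1) ^ 3 : ℝ) : ℂ) := by
  have h : (1 - (normSq2 z.1 : ℂ)) ≠ 0 := by
    exact_mod_cast (one_sub_normSq2_pos z).ne'
  have hs : (normSq2 z.1 : ℂ) = z.1 0 * star (z.1 0) + z.1 1 * star (z.1 1) := by
    simp [normSq2, Complex.mul_conj, Complex.normSq_eq_norm_sq]
  rw [Matrix.det_fin_two]
  simp only [hypMetric, Matrix.of_apply, if_true, Fin.zero_eq_one_iff, Fin.one_eq_zero_iff,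
    OfNat.ofNat_ne_one, if_false, zero_add]
  push_cast
  field_simp
  rw [hs]
  ring

/-- The hyperbolic volume measure `(1 - |z|²)⁻³ · (Lebesgue measure)` on the ball. -/
def hypVol : MeasureTheory.Measure Ball2 :=
  (MeasureTheory.Measure.comap Subtype.val MeasureTheory.volume).withDensity
    fun z => ENNReal.ofReal (1 / (1 - normSq2 z.1) ^ 3)

/-- The hyperbolic distance on the ball, given by
`cosh² (d(z,w)/2) = ⟨z̃, w̃⟩⟨w̃, z̃⟩ / (⟨z̃, z̃⟩⟨w̃, w̃⟩)`. -/
def hypDist (z w : Ball2) : ℝ :=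
  2 * Real.arcosh (‖herm (lift3 z.1) (lift3 w.1)‖ /
    Real.sqrt ((1 - normSq2 z.1) * (1 - normSq2 w.1)))

/-! # The quotient surface -/

/-- The quotient `X_Γ = Γ \ 𝔹²`, with the quotient topology. -/
abbrev PicardSurface (Γ : Subgroup SU21) : Type := MulAction.orbitRel.Quotient Γ Ball2

/-- The projection `𝔹² → X_Γ`. -/
def proj (Γ : Subgroup SU21) (z : Ball2) : PicardSurface Γ := Quotient.mk _ z

/-- The geodesic distance on `X_Γ`: the least distance between lifts of the two points. -/
def surfDist (Γ : Subgroup SU21) (x y : PicardSurface Γ) : ℝ :=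
  sInf {r | ∃ z w : Ball2, proj Γ z = x ∧ proj Γ w = y ∧ r = hypDist z w}

/-! # Pluricanonical forms -/

/-- The fibre of `Ω²` at a point of the ball: alternating complex-bilinear forms on the
holomorphic tangent space `ℂ²`. -/
abbrev Form2 : Type := (Fin 2 → ℂ) [⋀^Fin 2]→ₗ[ℂ] ℂ

/-- The fibre of `(Ω²)^{⊗k}` at a point of the ball. -/
abbrev PluriFibre (k : ℕ) : Type := PiTensorProduct ℂ (fun _ : Fin k => Form2)

/-- Pull-back of 2-forms under a linear map of tangent spaces. -/
def pullForm (L : (Fin 2 → ℂ) →ₗ[ℂ] (Fin 2 → ℂ)) : Form2 →ₗ[ℂ] Form2 where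
  toFun η := η.compLinearMap L
  map_add' _ _ := rfl
  map_smul' _ _ := rfl

/-- Pull-back of `k`-fold pluricanonical covectors under a linear map of tangent spaces. -/
def pullPluri (k : ℕ) (L : (Fin 2 → ℂ) →ₗ[ℂ] (Fin 2 → ℂ)) : PluriFibre k →ₗ[ℂ] PluriFibre k :=
  PiTensorProduct.map fun _ => pullForm L

/-- The form `dz₁ ∧ dz₂`. -/
def dzForm : Form2 := Matrix.detRowAlternating

/-- The frame `(dz₁ ∧ dz₂)^{⊗k}` of `(Ω²)^{⊗k}` on the ball. -/
def dzFrame (k : ℕ) : PluriFibre k := PiTensorProduct.tprod ℂ fun _ => dzForm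

/-- Coefficient of an element of `(Ω²)^{⊗k}` with respect to `(dz₁ ∧ dz₂)^{⊗k}`: it maps
`η₁ ⊗ ⋯ ⊗ η_k` to the product of the numbers `η_j(e₁, e₂)`. -/
def coeffDz (k : ℕ) : PluriFibre k →ₗ[ℂ] ℂ :=
  PiTensorProduct.lift
    ((MultilinearMap.mkPiAlgebra ℂ (Fin k) ℂ).compLinearMap fun _ =>
      { toFun := fun η : Form2 => η (fun i => Pi.single i 1)
        map_add' := fun _ _ => rfl
        map_smul' := fun _ _ => rfl })

theorem coeffDz_dzFrame (k : ℕ) : coeffDz k (dzFrame k) = 1 := by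
  have h : (fun i : Fin 2 => (Pi.single i 1 : Fin 2 → ℂ)) = (1 : Matrix (Fin 2) (Fin 2) ℂ) := by
    ext i j
    simp [Matrix.one_apply, Pi.single_apply, eq_comm]
  have h1 : dzForm (fun i : Fin 2 => (Pi.single i 1 : Fin 2 → ℂ)) = 1 := by
    rw [h]
    exact Matrix.det_one
  simp [coeffDz, dzFrame, h1]

/-- `H⁰(X_Γ, (Ω²)^{⊗k})`: the holomorphic sections of `(Ω²)^{⊗k}` on the ball that are invariant
under pull-back by every element of `Γ`, that is, that descend to `X_Γ = Γ \ 𝔹²`. -/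
def H0 (Γ : Subgroup SU21) (k : ℕ) : Submodule ℂ (Ball2 → PluriFibre k) where
  carrier := {ω |
    (∃ f : (Fin 2 → ℂ) → ℂ, DifferentiableOn ℂ f ballSet ∧
      ∀ z : Ball2, ω z = f z.1 • dzFrame k) ∧
    ∀ (γ : Γ) (z : Ball2),
      pullPluri k (fderiv ℂ (fracLin (γ : Matrix.SpecialLinearGroup (Fin 3) ℂ)) z.1 :
        (Fin 2 → ℂ) →ₗ[ℂ] (Fin 2 → ℂ)) (ω (γ • z)) = ω z}
  zero_mem' := ⟨⟨0, differentiableOn_const 0, fun z => by simp⟩, fun γ z => by simp⟩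
  add_mem' := by
    rintro ω η ⟨⟨f, hf, hωf⟩, hω⟩ ⟨⟨g, hg, hηg⟩, hη⟩
    refine ⟨⟨f + g, hf.add hg, fun z => ?_⟩, fun γ z => ?_⟩
    · simp [hωf z, hηg z, add_smul]
    · rw [Pi.add_apply, Pi.add_apply, map_add, hω γ z, hη γ z]
  smul_mem' := by
    rintro c ω ⟨⟨f, hf, hωf⟩, hω⟩
    refine ⟨⟨c • f, hf.const_smul c, fun z => ?_⟩, fun γ z => ?_⟩
    · simp [hωf z, mul_smul]
    · rw [Pi.smul_apply, Pi.smul_apply, map_smul, hω γ z]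

/-- The squared hyperbolic norm of `(dz₁ ∧ dz₂)^{⊗k}` at `z`. The metric induced on `Ω²` by the
Hermitian matrix `g` satisfies `|dz₁ ∧ dz₂|² = 1 / det g`, which is `(1 - |z|²)³`. -/
def frameNormSq (k : ℕ) (z : Ball2) : ℝ := (((hypMetric z).det.re)⁻¹) ^ k

/-- The point-wise Hermitian product on `(Ω²)^{⊗k}` at `z` induced by the hyperbolic metric. -/
def fibreInner (k : ℕ) (z : Ball2) (a b : PluriFibre k) : ℂ :=
  coeffDz k a * star (coeffDz k b) * (frameNormSq k z : ℂ)

/-- The `L²` inner product of sections over `X_Γ`, as an integral over the fundamental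
domain `F`. -/
def l2Inner (F : Set Ball2) (k : ℕ) (ω η : Ball2 → PluriFibre k) : ℂ :=
  ∫ z in F, fibreInner k z (ω z) (η z) ∂hypVol

/-- A basis of `H⁰(X_Γ, (Ω²)^{⊗k})` is orthonormal for the `L²` inner product. -/
def IsL2Orthonormal {Γ : Subgroup SU21} {k d : ℕ} (F : Set Ball2)
    (b : Module.Basis (Fin d) ℂ (H0 Γ k)) : Prop :=
  ∀ i j, l2Inner F k (b i).1 (b j).1 = if i = j then 1 else 0

/-- The Bergman kernel `∑_j ω_j(z) ⊗ conj (ω_j(w))` of a basis, written as a coefficient with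
respect to the frame `(dz₁ ∧ dz₂)^{⊗k} ⊗ conj (dw₁ ∧ dw₂)^{⊗k}`. -/
def bergmanKernel {Γ : Subgroup SU21} {k d : ℕ} (b : Module.Basis (Fin d) ℂ (H0 Γ k))
    (z w : Ball2) : ℂ :=
  ∑ j, coeffDz k ((b j).1 z) * star (coeffDz k ((b j).1 w))

/-- The point-wise hyperbolic norm of the Bergman kernel at `(z, w)`. -/
def bergmanNorm {Γ : Subgroup SU21} {k d : ℕ} (b : Module.Basis (Fin d) ℂ (H0 Γ k))
    (z w : Ball2) : ℝ :=
  ‖bergmanKernel b z w‖ * (Real.sqrt (frameNormSq k z) * Real.sqrt (frameNormSq k w))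

end

/-!
Let `j(γ, z)` be the automorphy factor, `B(z, w) = 1 - z₁ w̄₁ - z₂ w̄₂` and `m = 3k`, and let `c` be
the integral of `(1 - |z|²)^m` against the hyperbolic volume `μ` of the ball. The mean value
property of holomorphic functions at the origin, moved around by `SU(2,1)`, says that
`∫ f(z) B(w, z)^(-m) (1 - |z|²)^m dμ(z) = c f(w)` on the ball. Unfolding turns this into the
statement that the Poincaré series `∑_γ (j(γ, w)‾ B(z, γw))^(-m)` reproduces the sections of `Λ^k`
on the quotient up to the factor `c`, so it equals `c` times the Bergman kernel, and `c` is at least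
a constant times `k^(-2)`.

The term of `γ` has point-wise norm `cosh(d(z, γw)/2)^(-m)`. Since `d(z, γw)` is at least the
distance on the quotient, `m - n` of its factors can be pulled out of the sum. What remains is
`∑_γ cosh(d(z, γw)/2)^(-n)`; by cocompactness it is bounded uniformly by a multiple of its value at
`z = w = 0`, which for `n ≥ 6` is finite because unfolding the finite integral of `(1 - |z|²)³`
against `μ` gives the sum of the `|j(γ, 0)|^(-6)` up to constants.
-/

open MeasureTheory

section MeanValue

variable {α E F : Type*} [NormedAddCommGroup F] [NormedSpace ℂ F] [CompleteSpace F]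

theorem integral_circleAverage_smul [MeasurableSpace α] [MulAction ℂ α] [MeasurableSMul₂ ℂ α]
    {ν : Measure α} [SFinite ν]
    (hν : ∀ c : ℂ, ‖c‖ = 1 → MeasurePreserving (fun x : α => c • x) ν ν) {h : α → F}
    (hh : Integrable h ν) :
    ∫ x, Real.circleAverage (fun c : ℂ => h (c • x)) 0 1 ∂ν = ∫ x, h x ∂ν := by
  set σ : Measure ℝ := volume.restrict (Set.Ioc 0 (2 * Real.pi))
  have hnorm (θ : ℝ) : ‖circleMap 0 1 θ‖ = 1 := by simp
  have hrot : MeasurePreserving (fun p : ℝ × α => (p.1, circleMap 0 1 p.1 • p.2))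
      (σ.prod ν) (σ.prod ν) := by
    refine (MeasurePreserving.id σ).skew_product ?_
      (Filter.Eventually.of_forall fun θ => (hν _ (hnorm θ)).map_eq)
    exact ((continuous_circleMap 0 1).measurable.comp measurable_fst).smul measurable_snd
  have hint : Integrable (fun p : ℝ × α => h (circleMap 0 1 p.1 • p.2)) (σ.prod ν) :=
    hrot.integrable_comp_of_integrable (hh.comp_snd σ)
  have hslice (θ : ℝ) : ∫ x, h (circleMap 0 1 θ • x) ∂ν = ∫ x, h x ∂ν :=
    (hν _ (hnorm θ)).integral_comp
      (measurableEmbedding_const_smul₀ (norm_ne_zero_iff.mp (by simp [hnorm]))) h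
  simp only [Real.circleAverage_def, intervalIntegral.integral_of_le Real.two_pi_pos.le]
  rw [integral_smul, ← integral_integral_swap hint]
  simp only [hslice, integral_const, measureReal_restrict_apply_univ, Real.volume_real_Ioc,
    sub_zero, max_eq_left Real.two_pi_pos.le]
  exact inv_smul_smul₀ Real.two_pi_pos.ne' _

variable [NormedAddCommGroup E] [NormedSpace ℂ E]

theorem circleAverage_smul_of_balanced {U : Set E} (hU : IsOpen U) (hbal : Balanced ℂ U)
    {f : E → F} (hf : DifferentiableOn ℂ f U) {z : E} (hz : z ∈ U) :
    Real.circleAverage (fun c : ℂ => f (c • z)) 0 1 = f 0 := by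
  have hd : ∀ c ∈ Metric.closedBall (0 : ℂ) |1|, DifferentiableAt ℂ (fun c : ℂ => f (c • z)) c := by
    intro c hc
    have hcz : c • z ∈ U := hbal.smul_mem (by simpa using hc) hz
    exact (hf.differentiableAt (hU.mem_nhds hcz)).comp c (differentiableAt_id.smul_const z)
  rw [circleAverage_of_differentiable_on_off_countable Set.countable_empty
    (fun c hc => (hd c hc).continuousAt.continuousWithinAt)
    (fun c hc => hd c (Metric.ball_subset_closedBall hc.1)), zero_smul]

theorem integral_radial_smul_of_differentiableOn [MeasurableSpace E] [MeasurableSMul₂ ℂ E]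
    {ν : Measure E} [SFinite ν]
    (hν : ∀ c : ℂ, ‖c‖ = 1 → MeasurePreserving (fun x : E => c • x) ν ν)
    {U : Set E} (hU : IsOpen U) (hbal : Balanced ℂ U) (hνU : ∀ᵐ z ∂ν, z ∈ U)
    {f : E → F} (hf : DifferentiableOn ℂ f U)
    {ρ : E → ℝ} (hρ : ∀ (c : ℂ) (z : E), ‖c‖ = 1 → ρ (c • z) = ρ z)
    (hint : Integrable (fun z => ρ z • f z) ν) :
    ∫ z, ρ z • f z ∂ν = (∫ z, ρ z ∂ν) • f 0 := by
  rw [← integral_circleAverage_smul hν hint, ← integral_smul_const]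
  refine integral_congr_ae (hνU.mono fun z hz => ?_)
  beta_reduce
  rw [← circleAverage_smul_of_balanced hU hbal hf hz, ← Real.circleAverage_fun_smul]
  exact Real.circleAverage_congr_sphere fun c hc =>
    congrArg (· • f (c • z)) (hρ c z (by simpa using hc))

end MeanValue

section Unfolding

variable {G X E : Type*} [Group G] [Countable G] [MulAction G X] [MeasurableSpace X]
  [MeasurableConstSMul G X] {μ : Measure X} [SMulInvariantMeasure G X μ] {F : Set X}
  [NormedAddCommGroup E] {f : X → E}

theorem ae_summable_norm_smul (hF : IsFundamentalDomain G F μ) (hf : Integrable f μ) :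
    ∀ᵐ x ∂μ.restrict F, Summable fun g : G => ‖f (g • x)‖ := by
  have hmeas (g : G) : AEMeasurable (fun x => ‖f (g • x)‖ₑ) (μ.restrict F) :=
    (hf.1.comp_measurePreserving (measurePreserving_smul g μ)).enorm.restrict
  have hfin : ∫⁻ x in F, ∑' g : G, ‖f (g • x)‖ₑ ∂μ ≠ ⊤ := by
    rw [lintegral_tsum hmeas, ← hF.lintegral_eq_tsum'' fun x => ‖f x‖ₑ]
    exact hf.2.ne
  filter_upwards [ae_lt_top' (AEMeasurable.tsum hmeas) hfin] with x hx
  simpa only [toReal_enorm] using ENNReal.summable_toReal hx.ne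

theorem setIntegral_tsum_inv_smul [NormedSpace ℝ E] (hF : IsFundamentalDomain G F μ)
    (hf : Integrable f μ) : ∫ x in F, ∑' g : G, f (g⁻¹ • x) ∂μ = ∫ x, f x ∂μ := by
  rw [hF.integral_eq_tsum' f hf, integral_tsum]
  · exact fun g => (hf.1.comp_measurePreserving (measurePreserving_smul g⁻¹ μ)).restrict
  · rw [← hF.lintegral_eq_tsum' fun x => ‖f x‖ₑ]
    exact hf.2.ne

end Unfolding

section BallGeometry

/-- The automorphy factor of `g ∈ SU(2,1)`, that is, the denominator `C z + D` of the fractional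
linear map of `g`. -/
noncomputable def autFactor (g : SU21) (z : Fin 2 → ℂ) : ℂ := g.1.1.mulVec (lift3 z) 2

/-- The polarization `1 - z₁ w̄₁ - z₂ w̄₂` of `1 - |z|²`, which is `-⟨z̃, w̃⟩`. -/
noncomputable def ballPairing (z w : Fin 2 → ℂ) : ℂ := 1 - z 0 * star (w 0) - z 1 * star (w 1)

/-- The origin of the ball. -/
def ballOrigin : Ball2 := ⟨0, by simp [ballSet, normSq2]⟩

theorem herm_lift3 (z w : Fin 2 → ℂ) : herm (lift3 z) (lift3 w) = -ballPairing z w := by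
  simp only [herm_apply, lift3, ballPairing, Matrix.cons_val_zero, Matrix.cons_val_one,
    Matrix.cons_val, star_one]
  ring

theorem ballPairing_self (z : Fin 2 → ℂ) : ballPairing z z = ((1 - normSq2 z : ℝ) : ℂ) := by
  simp only [ballPairing, normSq2, Complex.star_def, Complex.mul_conj, Complex.normSq_eq_norm_sq]
  push_cast
  ring

theorem star_ballPairing (z w : Fin 2 → ℂ) : star (ballPairing z w) = ballPairing w z := by
  simp [ballPairing, mul_comm]

theorem norm_ballPairing_comm (z w : Fin 2 → ℂ) : ‖ballPairing z w‖ = ‖ballPairing w z‖ := by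
  rw [← star_ballPairing, norm_star]

theorem ballPairing_zero_right (z : Fin 2 → ℂ) : ballPairing z 0 = 1 := by simp [ballPairing]

theorem normSq2_nonneg (z : Fin 2 → ℂ) : 0 ≤ normSq2 z :=
  add_nonneg (sq_nonneg _) (sq_nonneg _)

theorem sqrt_normSq2_lt_one (z : Ball2) : √(normSq2 z.1) < 1 := by
  rw [Real.sqrt_lt' one_pos, one_pow]
  exact z.2

theorem norm_one_sub_ballPairing_le (z w : Fin 2 → ℂ) :
    ‖1 - ballPairing z w‖ ≤ √(normSq2 z) * √(normSq2 w) := by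
  have htriangle : ‖1 - ballPairing z w‖ ≤ ‖z 0‖ * ‖w 0‖ + ‖z 1‖ * ‖w 1‖ := by
    have : 1 - ballPairing z w = z 0 * star (w 0) + z 1 * star (w 1) := by
      unfold ballPairing
      ring
    rw [this]
    exact (norm_add_le _ _).trans_eq (by simp only [norm_mul, norm_star])
  rw [← Real.sqrt_mul (normSq2_nonneg z)]
  refine Real.le_sqrt_of_sq_le ((pow_le_pow_left₀ (norm_nonneg _) htriangle 2).trans ?_)
  unfold normSq2
  nlinarith only [sq_nonneg (‖z 0‖ * ‖w 1‖ - ‖z 1‖ * ‖w 0‖)]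

theorem one_sub_sqrt_mul_sqrt_le_norm_ballPairing (z w : Fin 2 → ℂ) :
    1 - √(normSq2 z) * √(normSq2 w) ≤ ‖ballPairing z w‖ := by
  have h := norm_sub_norm_le (1 : ℂ) (1 - ballPairing z w)
  rw [norm_one, sub_sub_cancel] at h
  linarith [norm_one_sub_ballPairing_le z w]

theorem one_sub_sqrt_le_norm_ballPairing (z w : Ball2) :
    1 - √(normSq2 z.1) ≤ ‖ballPairing z.1 w.1‖ :=
  (sub_le_sub_left (mul_le_of_le_one_right (Real.sqrt_nonneg _) (sqrt_normSq2_lt_one w).le) 1).trans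
    (one_sub_sqrt_mul_sqrt_le_norm_ballPairing z.1 w.1)

theorem ballPairing_ne_zero (z w : Ball2) : ballPairing z.1 w.1 ≠ 0 :=
  norm_pos_iff.mp <|
    (sub_pos.mpr (sqrt_normSq2_lt_one z)).trans_le (one_sub_sqrt_le_norm_ballPairing z w)

theorem norm_ballPairing_le_two (z w : Ball2) : ‖ballPairing z.1 w.1‖ ≤ 2 := by
  have h := norm_sub_norm_le (ballPairing z.1 w.1) 1
  rw [norm_one, norm_sub_rev] at h
  linarith [norm_one_sub_ballPairing_le z.1 w.1, mul_le_one₀ (sqrt_normSq2_lt_one z).le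
    (Real.sqrt_nonneg _) (sqrt_normSq2_lt_one w).le]

theorem one_sub_normSq2_mul_le_norm_ballPairing_sq (z w : Ball2) :
    (1 - normSq2 z.1) * (1 - normSq2 w.1) ≤ ‖ballPairing z.1 w.1‖ ^ 2 := by
  rw [← Real.sq_sqrt (normSq2_nonneg z.1), ← Real.sq_sqrt (normSq2_nonneg w.1)]
  have hzw : √(normSq2 z.1) * √(normSq2 w.1) ≤ 1 := mul_le_one₀ (sqrt_normSq2_lt_one z).le
    (Real.sqrt_nonneg _) (sqrt_normSq2_lt_one w).le
  calc (1 - √(normSq2 z.1) ^ 2) * (1 - √(normSq2 w.1) ^ 2)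
      ≤ (1 - √(normSq2 z.1) * √(normSq2 w.1)) ^ 2 := by
        nlinarith only [sq_nonneg (√(normSq2 z.1) - √(normSq2 w.1))]
    _ ≤ _ := pow_le_pow_left₀ (sub_nonneg.mpr hzw)
        (one_sub_sqrt_mul_sqrt_le_norm_ballPairing z.1 w.1) 2

theorem autFactor_ne_zero (g : SU21) (z : Ball2) : autFactor g z.1 ≠ 0 := denom_ne_zero g.2 z.2

theorem autFactor_smul_lift3 (g : SU21) (z : Ball2) :
    autFactor g z.1 • lift3 (g • z).1 = g.1.1.mulVec (lift3 z.1) :=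
  smul_lift3_fracLin (denom_ne_zero g.2 z.2)

theorem autFactor_one (z : Fin 2 → ℂ) : autFactor 1 z = 1 := by simp [autFactor, lift3]

theorem autFactor_mul (g h : SU21) (z : Ball2) :
    autFactor (g * h) z.1 = autFactor g (h • z).1 * autFactor h z.1 := by
  have hmul : autFactor (g * h) z.1 = g.1.1.mulVec (h.1.1.mulVec (lift3 z.1)) 2 := by
    rw [Matrix.mulVec_mulVec]
    rfl
  rw [hmul, ← autFactor_smul_lift3, Matrix.mulVec_smul, mul_comm]
  rfl

theorem ballPairing_smul_smul (g : SU21) (z w : Ball2) :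
    autFactor g z.1 * star (autFactor g w.1) * ballPairing (g • z).1 (g • w).1 =
      ballPairing z.1 w.1 := by
  have h := herm_mulVec g.2 (lift3 z.1) (lift3 w.1)
  rw [← autFactor_smul_lift3, ← autFactor_smul_lift3, herm, star_smul, Matrix.mulVec_smul,
    smul_dotProduct, dotProduct_smul, ← herm, herm_lift3, herm_lift3, smul_eq_mul, smul_eq_mul] at h
  linear_combination -h

theorem one_sub_normSq2_smul (g : SU21) (z : Ball2) :
    ‖autFactor g z.1‖ ^ 2 * (1 - normSq2 (g • z).1) = 1 - normSq2 z.1 := by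
  have h := ballPairing_smul_smul g z z
  rw [ballPairing_self, ballPairing_self, Complex.star_def, Complex.mul_conj,
    Complex.normSq_eq_norm_sq] at h
  exact_mod_cast h

theorem autFactor_eq_star_mul_ballPairing (g : SU21) (z w : Ball2) :
    autFactor g z.1 * ballPairing (g • z).1 w.1 =
      star (autFactor g⁻¹ w.1) * ballPairing z.1 (g⁻¹ • w).1 := by
  rw [← ballPairing_smul_smul g z (g⁻¹ • w), smul_inv_smul]
  have h : star (autFactor g⁻¹ w.1) * star (autFactor g (g⁻¹ • w).1) = 1 := by
    rw [← star_mul, ← autFactor_mul, mul_inv_cancel, autFactor_one, star_one]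
  linear_combination -(autFactor g z.1 * ballPairing (g • z).1 w.1) * h

theorem norm_autFactor_eq (g : SU21) (z : Ball2) :
    ‖autFactor g z.1‖ = ‖autFactor g⁻¹ 0‖ * ‖ballPairing z.1 (g⁻¹ • ballOrigin).1‖ := by
  have h := autFactor_eq_star_mul_ballPairing g z ballOrigin
  rw [show ballOrigin.1 = 0 from rfl, ballPairing_zero_right, mul_one] at h
  rw [h, norm_mul, norm_star]

theorem norm_autFactor_inv_zero (g : SU21) : ‖autFactor g⁻¹ 0‖ = ‖autFactor g 0‖ := by
  have h := norm_autFactor_eq g ballOrigin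
  rw [show ballOrigin.1 = 0 from rfl, norm_ballPairing_comm, ballPairing_zero_right, norm_one,
    mul_one] at h
  exact h.symm

theorem one_le_norm_autFactor_zero (g : SU21) : 1 ≤ ‖autFactor g 0‖ := by
  have h : ‖autFactor g 0‖ ^ 2 * (1 - normSq2 (g • ballOrigin).1) = 1 := by
    rw [show (0 : Fin 2 → ℂ) = ballOrigin.1 from rfl, one_sub_normSq2_smul]
    simp [ballOrigin, normSq2]
  refine one_le_sq_iff₀ (norm_nonneg _) |>.mp ?_
  nlinarith only [h, normSq2_nonneg (g • ballOrigin).1, sq_nonneg ‖autFactor g 0‖]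

theorem norm_autFactor_le (g : SU21) (z : Ball2) : ‖autFactor g z.1‖ ≤ 2 * ‖autFactor g 0‖ := by
  rw [norm_autFactor_eq, norm_autFactor_inv_zero, mul_comm]
  exact mul_le_mul_of_nonneg_right (norm_ballPairing_le_two _ _) (norm_nonneg _)

theorem le_norm_autFactor (g : SU21) (z : Ball2) :
    (1 - √(normSq2 z.1)) * ‖autFactor g 0‖ ≤ ‖autFactor g z.1‖ := by
  rw [norm_autFactor_eq, norm_autFactor_inv_zero, mul_comm]
  exact mul_le_mul_of_nonneg_left (one_sub_sqrt_le_norm_ballPairing _ _) (norm_nonneg _)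

end BallGeometry

section Transitivity

open Matrix

/-- The reflection `u ↦ u - 2 ⟨u, v⟩ ⟨v, v⟩⁻¹ v` of `ℂ³` in the orthogonal complement of an
anisotropic vector `v` for the form of signature (2,1); it is the identity when `⟨v, v⟩ = 0`. -/
noncomputable def hermReflection (v : Fin 3 → ℂ) : Matrix (Fin 3) (Fin 3) ℂ :=
  1 - (2 / herm v v) • vecMulVec v (star v ᵥ* formH)

theorem hermReflection_mulVec (v u : Fin 3 → ℂ) :
    hermReflection v *ᵥ u = u - (2 / herm v v * herm u v) • v := by
  rw [hermReflection, sub_mulVec, one_mulVec, smul_mulVec, vecMulVec_mulVec, ← dotProduct_mulVec,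
    ← herm, op_smul_eq_smul, smul_smul]

theorem herm_add_add (u v : Fin 3 → ℂ) :
    herm (u + v) (u + v) = herm u u + herm u v + (herm v u + herm v v) := by
  simp only [herm_apply, Pi.add_apply, star_add]
  ring

theorem conjTranspose_formH : formHᴴ = formH := by
  rw [formH, diagonal_conjTranspose]
  congr 1
  ext i
  fin_cases i <;> simp

theorem conjTranspose_hermReflection_mul {v : Fin 3 → ℂ} (hv : herm v v ≠ 0) :
    (hermReflection v)ᴴ * formH * hermReflection v = formH := by
  set P := vecMulVec v (star v ᵥ* formH) with hP
  have hPH : Pᴴ * formH = formH * P := by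
    rw [hP, conjTranspose_vecMulVec, star_vecMul, star_star, conjTranspose_formH, mul_vecMulVec,
      vecMulVec_mul]
  have hPP : P * P = herm v v • P := by
    rw [hP, vecMulVec_mul_vecMulVec, ← dotProduct_mulVec, ← herm, vecMulVec_smul]
  have hreal : star (2 / herm v v) = 2 / herm v v := by
    rw [herm_self]
    simp
  have hPcP : P * (2 / herm v v) • P = (2 : ℂ) • P := by
    rw [mul_smul_comm, hPP, smul_smul, div_mul_cancel₀ _ hv]
  rw [hermReflection, ← hP, conjTranspose_sub, conjTranspose_one, conjTranspose_smul, hreal,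
    sub_mul, one_mul, smul_mul_assoc, hPH, mul_sub, mul_one, sub_mul, smul_mul_assoc,
    Matrix.mul_assoc, hPcP, mul_smul_comm, mul_smul_comm, two_smul, smul_add]
  abel

theorem det_hermReflection {v : Fin 3 → ℂ} (hv : herm v v ≠ 0) : (hermReflection v).det = -1 := by
  rw [hermReflection, ← smul_vecMulVec, sub_eq_add_neg, ← neg_vecMulVec, vecMulVec_eq Unit,
    det_one_add_replicateCol_mul_replicateRow, dotProduct_neg, dotProduct_smul,
    ← dotProduct_mulVec, ← herm, smul_eq_mul, div_mul_cancel₀ _ hv]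
  norm_num

theorem neg_hermReflection_add_mulVec {u v : Fin 3 → ℂ} (huv : herm u u = herm v v)
    (hsymm : herm u v = herm v u) (h : herm (u + v) (u + v) ≠ 0) :
    (-hermReflection (u + v)) *ᵥ u = v := by
  have hsum : herm (u + v) (u + v) = 2 * herm u (u + v) := by
    have : herm u (u + v) = herm u u + herm u v := by
      simp only [herm_apply, Pi.add_apply, star_add]
      ring
    linear_combination herm_add_add u v - 2 * this - huv - hsymm
  have hcoef : 2 / herm (u + v) (u + v) * herm u (u + v) = 1 := by
    rw [div_mul_eq_mul_div, ← hsum, div_self h]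
  rw [neg_mulVec, hermReflection_mulVec, hcoef, one_smul, sub_add_cancel_left, neg_neg]

theorem fracLin_eq_of_mulVec_lift3 {M : Matrix (Fin 3) (Fin 3) ℂ} {z w : Fin 2 → ℂ} {c : ℂ}
    (hc : c ≠ 0) (h : M *ᵥ lift3 z = c • lift3 w) : fracLin M z = w := by
  funext i
  rw [fracLin, h]
  fin_cases i <;> simp [lift3, hc]

theorem exists_smul_ballOrigin (w : Ball2) : ∃ g : SU21, g • ballOrigin = w := by
  have hw := one_sub_normSq2_pos w
  set s : ℝ := (√(1 - normSq2 w.1))⁻¹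
  have hs : 0 < s := by positivity
  have hsq : s ^ 2 * (1 - normSq2 w.1) = 1 := by
    rw [inv_pow, Real.sq_sqrt hw.le, inv_mul_cancel₀ hw.ne']
  -- The reflection in `u - v` would map `u` to `v` as well, but `u = v` when `w = 0`, whereas
  -- `u + v` is never isotropic. The sign turns the determinant `-1` of a reflection into `1`.
  set u : Fin 3 → ℂ := lift3 0
  set v : Fin 3 → ℂ := (s : ℂ) • lift3 w.1
  have huu : herm u u = -1 := by simp [u, herm_apply, lift3]
  have huv : herm u v = -s := by simp [u, v, herm_apply, lift3]
  have hvu : herm v u = -s := by simp [u, v, herm_apply, lift3]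
  have hvv : herm v v = -1 := by
    have : herm v v = s ^ 2 * herm (lift3 w.1) (lift3 w.1) := by
      simp only [v, herm_apply, Pi.smul_apply, smul_eq_mul, star_mul', Complex.star_def,
        Complex.conj_ofReal]
      ring
    rw [this, herm_lift3, ballPairing_self, mul_neg]
    exact_mod_cast congrArg Neg.neg hsq
  have hne : herm (u + v) (u + v) ≠ 0 := by
    have : herm (u + v) (u + v) = ((-(2 * (1 + s)) : ℝ) : ℂ) := by
      rw [herm_add_add, huu, huv, hvu, hvv]
      push_cast
      ring
    rw [this, Complex.ofReal_ne_zero]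
    exact neg_ne_zero.mpr (by positivity)
  refine ⟨⟨⟨-hermReflection (u + v), ?_⟩, ?_⟩, Subtype.ext ?_⟩
  · rw [det_neg, det_hermReflection hne]
    norm_num
  · change (-hermReflection (u + v))ᴴ * formH * -hermReflection (u + v) = formH
    rw [conjTranspose_neg, neg_mul, neg_mul_neg, conjTranspose_hermReflection_mul hne]
  · exact fracLin_eq_of_mulVec_lift3 (Complex.ofReal_ne_zero.mpr hs.ne')
      (neg_hermReflection_add_mulVec (huu.trans hvv.symm) (huv.trans hvu.symm) hne)

end Transitivity

section PluricanonicalForms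

theorem continuous_normSq2 : Continuous normSq2 := by
  unfold normSq2
  fun_prop

theorem isOpen_ballSet : IsOpen ballSet := isOpen_lt continuous_normSq2 continuous_const

/-- The linear part of the `i`-th coordinate of the affine map `z ↦ M (z, 1)`. -/
noncomputable def rowMap (M : Matrix (Fin 3) (Fin 3) ℂ) (i : Fin 3) : (Fin 2 → ℂ) →L[ℂ] ℂ :=
  M i 0 • ContinuousLinearMap.proj 0 + M i 1 • ContinuousLinearMap.proj 1

theorem rowMap_apply (M : Matrix (Fin 3) (Fin 3) ℂ) (i : Fin 3) (z : Fin 2 → ℂ) :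
    rowMap M i z = M i 0 * z 0 + M i 1 * z 1 := rfl

theorem mulVec_lift3_apply (M : Matrix (Fin 3) (Fin 3) ℂ) (i : Fin 3) (z : Fin 2 → ℂ) :
    M.mulVec (lift3 z) i = rowMap M i z + M i 2 := by
  simp [Matrix.mulVec, dotProduct, Fin.sum_univ_three, lift3, rowMap_apply]

theorem hasFDerivAt_mulVec_lift3 (M : Matrix (Fin 3) (Fin 3) ℂ) (i : Fin 3) (z : Fin 2 → ℂ) :
    HasFDerivAt (fun z => M.mulVec (lift3 z) i) (rowMap M i) z := by
  simp only [mulVec_lift3_apply]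
  exact (rowMap M i).hasFDerivAt.add_const _

/-- The derivative at `z` of the fractional linear map of `M`, by the quotient rule. -/
noncomputable def fracLinDeriv (M : Matrix (Fin 3) (Fin 3) ℂ) (z : Fin 2 → ℂ) :
    (Fin 2 → ℂ) →L[ℂ] (Fin 2 → ℂ) :=
  ContinuousLinearMap.pi fun i : Fin 2 =>
    ((M.mulVec (lift3 z) 2) ^ 2)⁻¹ •
      (M.mulVec (lift3 z) 2 • rowMap M i.castSucc - M.mulVec (lift3 z) i.castSucc • rowMap M 2)

theorem hasFDerivAt_fracLin {M : Matrix (Fin 3) (Fin 3) ℂ} {z : Fin 2 → ℂ}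
    (hd : M.mulVec (lift3 z) 2 ≠ 0) : HasFDerivAt (fracLin M) (fracLinDeriv M z) z := by
  refine hasFDerivAt_pi'.mpr fun i => ?_
  have h := (hasFDerivAt_mulVec_lift3 M i.castSucc z).mul
    ((hasDerivAt_inv hd).comp_hasFDerivAt z (hasFDerivAt_mulVec_lift3 M 2 z))
  refine h.congr_fderiv (ContinuousLinearMap.ext fun v => ?_)
  simp only [fracLinDeriv, ContinuousLinearMap.proj_pi, Function.comp_apply, add_apply, sub_apply,
    smul_apply, smul_eq_mul, neg_mul, mul_neg]
  field_simp
  ring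

theorem det_fracLinDeriv {M : Matrix (Fin 3) (Fin 3) ℂ} {z : Fin 2 → ℂ}
    (hd : M.mulVec (lift3 z) 2 ≠ 0) :
    LinearMap.det (fracLinDeriv M z : (Fin 2 → ℂ) →ₗ[ℂ] (Fin 2 → ℂ)) =
      M.det / M.mulVec (lift3 z) 2 ^ 3 := by
  have hrow (i : Fin 3) : M.mulVec (lift3 z) i = M i 0 * z 0 + M i 1 * z 1 + M i 2 := by
    rw [mulVec_lift3_apply, rowMap_apply]
  have hentry (i j : Fin 2) : fracLinDeriv M z (Pi.single j 1) i =
      (M.mulVec (lift3 z) 2 * M i.castSucc j.castSucc -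
        M.mulVec (lift3 z) i.castSucc * M 2 j.castSucc) / M.mulVec (lift3 z) 2 ^ 2 := by
    rw [div_eq_inv_mul]
    fin_cases j <;> simp [fracLinDeriv, rowMap_apply]
  rw [← LinearMap.det_toMatrix', Matrix.det_fin_two]
  simp only [LinearMap.toMatrix'_apply, ContinuousLinearMap.coe_coe, hentry, Fin.castSucc_zero,
    Fin.castSucc_one]
  field_simp
  rw [Matrix.det_fin_three, hrow 0, hrow 1, hrow 2]
  ring

theorem det_fderiv_smul (g : SU21) (z : Ball2) :
    LinearMap.det (fderiv ℂ (fracLin (g : Matrix.SpecialLinearGroup (Fin 3) ℂ)) z.1 :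
      (Fin 2 → ℂ) →ₗ[ℂ] (Fin 2 → ℂ)) = (autFactor g z.1 ^ 3)⁻¹ := by
  rw [(hasFDerivAt_fracLin (autFactor_ne_zero g z)).fderiv,
    det_fracLinDeriv (autFactor_ne_zero g z), g.1.2, one_div]
  rfl

theorem pullForm_dzForm (L : (Fin 2 → ℂ) →ₗ[ℂ] (Fin 2 → ℂ)) :
    pullForm L dzForm = LinearMap.det L • dzForm := by
  ext v
  have h := (Pi.basisFun ℂ (Fin 2)).det_comp L v
  rwa [Pi.basisFun_det] at h

theorem pullPluri_dzFrame (k : ℕ) (L : (Fin 2 → ℂ) →ₗ[ℂ] (Fin 2 → ℂ)) :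
    pullPluri k L (dzFrame k) = LinearMap.det L ^ k • dzFrame k := by
  simp only [pullPluri, dzFrame, PiTensorProduct.map_tprod, pullForm_dzForm]
  rw [MultilinearMap.map_smul_univ, Finset.prod_const, Finset.card_fin]

theorem dzFrame_ne_zero (k : ℕ) : dzFrame k ≠ 0 := fun h => by
  simpa [h] using coeffDz_dzFrame k

theorem coeffDz_smul_dzFrame (k : ℕ) (a : ℂ) : coeffDz k (a • dzFrame k) = a := by
  rw [map_smul, coeffDz_dzFrame, smul_eq_mul, mul_one]

theorem pullPluri_fderiv_smul_dzFrame_eq_iff (k : ℕ) (g : SU21) (z : Ball2) (a b : ℂ) :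
    pullPluri k (fderiv ℂ (fracLin (g : Matrix.SpecialLinearGroup (Fin 3) ℂ)) z.1 :
      (Fin 2 → ℂ) →ₗ[ℂ] (Fin 2 → ℂ)) (a • dzFrame k) = b • dzFrame k ↔
      a = autFactor g z.1 ^ (3 * k) * b := by
  rw [map_smul, pullPluri_dzFrame, det_fderiv_smul, smul_smul, smul_left_inj (dzFrame_ne_zero k),
    inv_pow, ← pow_mul, mul_inv_eq_iff_eq_mul₀ (pow_ne_zero _ (autFactor_ne_zero g z)), mul_comm b]

theorem mem_H0_iff {Γ : Subgroup SU21} {k : ℕ} {ω : Ball2 → PluriFibre k} :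
    ω ∈ H0 Γ k ↔ ∃ f : (Fin 2 → ℂ) → ℂ, DifferentiableOn ℂ f ballSet ∧
      (∀ z : Ball2, ω z = f z.1 • dzFrame k) ∧
      ∀ (γ : Γ) (z : Ball2), f (γ • z).1 = autFactor γ z.1 ^ (3 * k) * f z.1 := by
  have hiff (f : (Fin 2 → ℂ) → ℂ) (hf : ∀ z : Ball2, ω z = f z.1 • dzFrame k) (γ : Γ)
      (z : Ball2) : pullPluri k (fderiv ℂ (fracLin (γ : Matrix.SpecialLinearGroup (Fin 3) ℂ)) z.1 :
        (Fin 2 → ℂ) →ₗ[ℂ] (Fin 2 → ℂ)) (ω (γ • z)) = ω z ↔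
      f (γ • z).1 = autFactor γ z.1 ^ (3 * k) * f z.1 := by
    rw [hf, hf, pullPluri_fderiv_smul_dzFrame_eq_iff]
  constructor
  · rintro ⟨⟨f, hf, hωf⟩, h⟩
    exact ⟨f, hf, hωf, fun γ z => (hiff f hωf γ z).mp (h γ z)⟩
  · rintro ⟨f, hf, hωf, h⟩
    exact ⟨⟨f, hf, hωf⟩, fun γ z => (hiff f hωf γ z).mpr (h γ z)⟩

theorem frameNormSq_eq (k : ℕ) (z : Ball2) : frameNormSq k z = (1 - normSq2 z.1) ^ (3 * k) := by
  rw [frameNormSq, hypMetric_det, Complex.ofReal_re, one_div, inv_inv, pow_mul]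

theorem fibreInner_smul_dzFrame (k : ℕ) (z : Ball2) (a b : ℂ) :
    fibreInner k z (a • dzFrame k) (b • dzFrame k) =
      a * star b * (((1 - normSq2 z.1) ^ (3 * k) : ℝ) : ℂ) := by
  rw [fibreInner, coeffDz_smul_dzFrame, coeffDz_smul_dzFrame, frameNormSq_eq]

end PluricanonicalForms

section HyperbolicVolume

theorem normSq2_smul (c : ℂ) (z : Fin 2 → ℂ) : normSq2 (c • z) = ‖c‖ ^ 2 * normSq2 z := by
  simp only [normSq2, Pi.smul_apply, norm_smul]
  ring

theorem balanced_ballSet : Balanced ℂ ballSet := by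
  refine balanced_iff_smul_mem.mpr fun {c} hc z hz => ?_
  change normSq2 (c • z) < 1
  rw [normSq2_smul]
  exact (mul_le_of_le_one_left (normSq2_nonneg z) (pow_le_one₀ (norm_nonneg c) hc)).trans_lt hz

theorem norm_le_one_of_mem_ballSet {z : Fin 2 → ℂ} (hz : z ∈ ballSet) : ‖z‖ ≤ 1 := by
  rw [pi_norm_le_iff_of_nonneg zero_le_one, Fin.forall_fin_two]
  have hz' : ‖z 0‖ ^ 2 + ‖z 1‖ ^ 2 < 1 := hz
  constructor <;> rw [← sq_le_one_iff₀ (norm_nonneg _)]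
  · linarith [sq_nonneg ‖z 1‖]
  · linarith [sq_nonneg ‖z 0‖]

theorem volume_ballSet_lt_top : volume ballSet < ⊤ :=
  (measure_mono fun _ hz => mem_closedBall_zero_iff.mpr (norm_le_one_of_mem_ballSet hz)).trans_lt
    (measure_closedBall_lt_top (x := (0 : Fin 2 → ℂ)) (r := 1))

theorem measurableEmbedding_ball_val : MeasurableEmbedding (Subtype.val : Ball2 → Fin 2 → ℂ) :=
  MeasurableEmbedding.subtype_coe isOpen_ballSet.measurableSet

theorem measurable_hypVol_density :
    Measurable fun z : Ball2 => ENNReal.ofReal (1 / (1 - normSq2 z.1) ^ 3) :=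
  (((measurable_const.sub (continuous_normSq2.measurable.comp measurable_subtype_coe)).pow_const
    3).const_div 1).ennreal_ofReal

theorem hypVol_apply {s : Set Ball2} (hs : MeasurableSet s) :
    hypVol s = ∫⁻ z in Subtype.val '' s, ENNReal.ofReal (1 / (1 - normSq2 z) ^ 3) := by
  rw [hypVol, withDensity_apply _ hs, setLIntegral_subtype isOpen_ballSet.measurableSet s
    fun z => ENNReal.ofReal (1 / (1 - normSq2 z) ^ 3)]

section Integral

variable {E : Type*} [NormedAddCommGroup E] [NormedSpace ℝ E]

theorem integral_hypVol (h : (Fin 2 → ℂ) → E) :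
    ∫ z : Ball2, h z.1 ∂hypVol = ∫ z in ballSet, (1 / (1 - normSq2 z) ^ 3) • h z := by
  rw [hypVol, integral_withDensity_eq_integral_toReal_smul measurable_hypVol_density
    (Filter.Eventually.of_forall fun _ => ENNReal.ofReal_lt_top),
    ← integral_subtype_comap isOpen_ballSet.measurableSet]
  refine integral_congr_ae (Filter.Eventually.of_forall fun z => ?_)
  have := one_sub_normSq2_pos z
  beta_reduce
  rw [ENNReal.toReal_ofReal (by positivity)]

theorem integrable_hypVol_iff (h : Ball2 → E) :
    Integrable h hypVol ↔ Integrable (fun z => (1 / (1 - normSq2 z.1) ^ 3) • h z)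
      (Measure.comap Subtype.val volume) := by
  rw [hypVol, integrable_withDensity_iff_integrable_smul' measurable_hypVol_density
    (Filter.Eventually.of_forall fun _ => ENNReal.ofReal_lt_top)]
  refine integrable_congr (Filter.Eventually.of_forall fun z => ?_)
  have := one_sub_normSq2_pos z
  beta_reduce
  rw [ENNReal.toReal_ofReal (by positivity)]

theorem integrable_hypVol_of_norm_le {h : Ball2 → E} (hh : Continuous h) {M : ℝ}
    (hM : ∀ z, ‖h z‖ ≤ M * (1 - normSq2 z.1) ^ 3) : Integrable h hypVol := by
  have : IsFiniteMeasure (Measure.comap (Subtype.val : Ball2 → Fin 2 → ℂ) volume) := ⟨by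
    rw [measurableEmbedding_ball_val.comap_apply, Set.image_univ, Subtype.range_coe]
    exact volume_ballSet_lt_top⟩
  have hpos (z : Ball2) : 0 < (1 - normSq2 z.1) ^ 3 := pow_pos (one_sub_normSq2_pos z) 3
  have hden : Continuous fun z : Ball2 => 1 / (1 - normSq2 z.1) ^ 3 :=
    continuous_const.div₀ ((continuous_const.sub
      (continuous_normSq2.comp continuous_subtype_val)).pow 3) fun z => (hpos z).ne'
  refine (integrable_hypVol_iff h).mpr (Integrable.of_bound
    (hden.smul hh).aestronglyMeasurable M (Filter.Eventually.of_forall fun z => ?_))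
  rw [norm_smul, Real.norm_of_nonneg (one_div_pos.mpr (hpos z)).le, one_div_mul_eq_div,
    div_le_iff₀ (hpos z)]
  exact hM z

end Integral

section Invariance

instance : ContinuousConstSMul SU21 Ball2 where
  continuous_const_smul g := by
    refine Continuous.subtype_mk (continuous_iff_continuousAt.mpr fun z => ?_) _
    exact (hasFDerivAt_fracLin (autFactor_ne_zero g z)).continuousAt.comp
      continuous_subtype_val.continuousAt

instance (Γ : Subgroup SU21) : ContinuousConstSMul Γ Ball2 where
  continuous_const_smul γ := continuous_const_smul (γ : SU21)

instance : MeasurableConstSMul SU21 Ball2 where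
  measurable_const_smul g := (continuous_const_smul g).measurable

theorem det_restrictScalars_fracLinDeriv (g : SU21) (z : Ball2) :
    ((fracLinDeriv g.1.1 z.1).restrictScalars ℝ).det = (‖autFactor g z.1‖ ^ 6)⁻¹ := by
  change LinearMap.det ((fracLinDeriv g.1.1 z.1 :
    (Fin 2 → ℂ) →ₗ[ℂ] (Fin 2 → ℂ)).restrictScalars ℝ) = _
  rw [LinearMap.det_restrictScalars, det_fracLinDeriv (autFactor_ne_zero g z), g.1.2, one_div,
    Algebra.norm_complex_apply, Complex.normSq_eq_norm_sq, norm_inv, norm_pow, inv_pow, ← pow_mul]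
  rfl

theorem val_image_eq_fracLin_image (g : SU21) (s : Set Ball2) :
    Subtype.val '' s = fracLin g.1.1 '' (Subtype.val '' ((g • ·) ⁻¹' s)) := by
  have himage : s = (g • ·) '' ((g • ·) ⁻¹' s) :=
    (Set.image_preimage_eq s (MulAction.surjective g)).symm
  conv_lhs => rw [himage, Set.image_image]
  rw [Set.image_image]
  rfl

theorem ofReal_det_mul_hypVol_density (g : SU21) (z : Ball2) :
    ENNReal.ofReal |((fracLinDeriv g.1.1 z.1).restrictScalars ℝ).det| *
      ENNReal.ofReal (1 / (1 - normSq2 (g • z).1) ^ 3) =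
    ENNReal.ofReal (1 / (1 - normSq2 z.1) ^ 3) := by
  have h1 := norm_pos_iff.mpr (autFactor_ne_zero g z)
  have h2 := one_sub_normSq2_pos (g • z)
  rw [← ENNReal.ofReal_mul (abs_nonneg _), det_restrictScalars_fracLinDeriv,
    abs_of_pos (by positivity), ← one_sub_normSq2_smul g z]
  congr 1
  field_simp

instance : SMulInvariantMeasure SU21 Ball2 hypVol where
  measure_preimage_smul g s hs := by
    have hpre : MeasurableSet ((g • ·) ⁻¹' s) := measurable_const_smul g hs
    rw [hypVol_apply hpre, hypVol_apply hs, val_image_eq_fracLin_image g s,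
      lintegral_image_eq_lintegral_abs_det_fderiv_mul volume
        (measurableEmbedding_ball_val.measurableSet_image.mpr hpre)
        (f' := fun z => (fracLinDeriv g.1.1 z).restrictScalars ℝ)]
    · refine setLIntegral_congr_fun (measurableEmbedding_ball_val.measurableSet_image.mpr hpre) ?_
      rintro _ ⟨z, -, rfl⟩
      exact (ofReal_det_mul_hypVol_density g z).symm
    · rintro _ ⟨z, -, rfl⟩
      exact ((hasFDerivAt_fracLin (autFactor_ne_zero g z)).restrictScalars ℝ).hasFDerivWithinAt
    · rintro _ ⟨z, -, rfl⟩ _ ⟨w, -, rfl⟩ h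
      exact congrArg Subtype.val (MulAction.injective g (Subtype.ext h : g • z = g • w))

theorem countable_of_discreteTopology (Γ : Subgroup SU21) [DiscreteTopology Γ] :
    Countable Γ := by
  have : SecondCountableTopology (Matrix (Fin 3) (Fin 3) ℂ) :=
    inferInstanceAs (SecondCountableTopology (Fin 3 → Fin 3 → ℂ))
  have : SecondCountableTopology (Matrix.SpecialLinearGroup (Fin 3) ℂ) :=
    TopologicalSpace.Subtype.secondCountableTopology {A : Matrix (Fin 3) (Fin 3) ℂ | A.det = 1}
  exact countable_of_Lindelof_of_discrete

end Invariance

section BallWeight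

/-- The weighted volume `∫ (1 - |z|²)^m dμ` of the ball for the hyperbolic volume `μ`: the inverse
of the normalizing constant of its Bergman kernel of weight `m`. -/
noncomputable def ballWeight (m : ℕ) : ℝ := ∫ z : Ball2, (1 - normSq2 z.1) ^ m ∂hypVol

theorem ballWeight_eq_setIntegral {m : ℕ} (hm : 3 ≤ m) :
    ballWeight m = ∫ z in ballSet, (1 - normSq2 z) ^ (m - 3) := by
  rw [ballWeight, integral_hypVol fun z => (1 - normSq2 z) ^ m]
  refine setIntegral_congr_fun isOpen_ballSet.measurableSet fun z hz => ?_
  have hz' : 1 - normSq2 z ≠ 0 := (one_sub_normSq2_pos ⟨z, hz⟩).ne'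
  rw [smul_eq_mul, one_div_mul_eq_div, pow_sub₀ _ hz' hm, div_eq_mul_inv]

theorem integrable_one_sub_normSq2_pow {m : ℕ} (hm : 3 ≤ m) :
    Integrable (fun z : Ball2 => (1 - normSq2 z.1) ^ m) hypVol := by
  refine integrable_hypVol_of_norm_le (M := 1)
    ((continuous_const.sub (continuous_normSq2.comp continuous_subtype_val)).pow m) fun z => ?_
  have hz := (one_sub_normSq2_pos z).le
  rw [Real.norm_of_nonneg (pow_nonneg hz m), one_mul]
  exact pow_le_pow_of_le_one hz (sub_le_self 1 (normSq2_nonneg z.1)) hm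

theorem normSq2_le_of_norm_le {z : Fin 2 → ℂ} {r : ℝ} (hz : ‖z‖ ≤ r) : normSq2 z ≤ 2 * r ^ 2 := by
  have h (i : Fin 2) : ‖z i‖ ^ 2 ≤ r ^ 2 :=
    pow_le_pow_left₀ (norm_nonneg _) ((norm_le_pi_norm z i).trans hz) 2
  exact (add_le_add (h 0) (h 1)).trans_eq (two_mul _).symm

theorem integrableOn_one_sub_normSq2_pow (n : ℕ) :
    IntegrableOn (fun z => (1 - normSq2 z) ^ n) ballSet := by
  have hcont : Continuous fun z => (1 - normSq2 z) ^ n :=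
    (continuous_const.sub continuous_normSq2).pow n
  refine IntegrableOn.of_bound volume_ballSet_lt_top hcont.aestronglyMeasurable 1
    (ae_restrict_of_forall_mem isOpen_ballSet.measurableSet fun z hz => ?_)
  have hz' := (one_sub_normSq2_pos ⟨z, hz⟩).le
  rw [Real.norm_of_nonneg (pow_nonneg hz' n)]
  exact pow_le_one₀ hz' (sub_le_self 1 (normSq2_nonneg z))

-- Bernoulli's inequality gives `(1 - |z|²)ⁿ ≥ 1/2` on a ball of radius of order `n^(-1/2)`.
theorem half_mul_volume_ball_le_setIntegral (n : ℕ) {r : ℝ} (hr : (n + 1) * (4 * r ^ 2) ≤ 1) :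
    volume.real (Metric.ball (0 : Fin 2 → ℂ) r) / 2 ≤
      ∫ z in ballSet, (1 - normSq2 z) ^ n := by
  have hsmall {z : Fin 2 → ℂ} (hz : z ∈ Metric.ball 0 r) : (n + 1) * normSq2 z ≤ 1 / 2 := by
    have := mul_le_mul_of_nonneg_left (normSq2_le_of_norm_le (mem_ball_zero_iff.mp hz).le)
      (n.cast_add_one_pos (α := ℝ)).le
    linarith
  have hle {z : Fin 2 → ℂ} (hz : z ∈ Metric.ball 0 r) : normSq2 z ≤ 1 / 2 := by
    nlinarith only [hsmall hz, normSq2_nonneg z, n.cast_nonneg (α := ℝ)]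
  have hsub : Metric.ball 0 r ⊆ ballSet := fun z hz => (hle hz).trans_lt one_half_lt_one
  calc volume.real (Metric.ball (0 : Fin 2 → ℂ) r) / 2
      = ∫ z in Metric.ball (0 : Fin 2 → ℂ) r, (1 / 2 : ℝ) := by
        rw [setIntegral_const, smul_eq_mul, mul_one_div]
    _ ≤ ∫ z in Metric.ball (0 : Fin 2 → ℂ) r, (1 - normSq2 z) ^ n := by
        refine setIntegral_mono_on (integrableOn_const measure_ball_lt_top.ne)
          ((integrableOn_one_sub_normSq2_pow n).mono_set hsub) measurableSet_ball fun z hz => ?_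
        have hbernoulli := one_add_mul_le_pow (a := -normSq2 z) (by linarith [hle hz]) n
        rw [← sub_eq_add_neg] at hbernoulli
        linarith [hsmall hz, normSq2_nonneg z]
    _ ≤ ∫ z in ballSet, (1 - normSq2 z) ^ n := by
        refine setIntegral_mono_set (integrableOn_one_sub_normSq2_pow n) ?_ hsub.eventuallyLE
        exact ae_restrict_of_forall_mem isOpen_ballSet.measurableSet fun z hz =>
          pow_nonneg (one_sub_normSq2_pos ⟨z, hz⟩).le n

theorem exists_le_ballWeight :
    ∃ c : ℝ, 0 < c ∧ ∀ m : ℕ, 3 ≤ m → c / (m : ℝ) ^ 2 ≤ ballWeight m := by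
  set V := volume.real (Metric.ball (0 : Fin 2 → ℂ) 1)
  have hV : 0 < V := ENNReal.toReal_pos (Metric.measure_ball_pos _ _ one_pos).ne'
    measure_ball_lt_top.ne
  refine ⟨V / 32, by positivity, fun m hm => ?_⟩
  obtain ⟨n, rfl⟩ := Nat.exists_eq_add_of_le' hm
  rw [ballWeight_eq_setIntegral hm, Nat.add_sub_cancel]
  set r : ℝ := √(1 / (4 * (n + 1)))
  have hr : r ^ 2 = 1 / (4 * (n + 1)) := Real.sq_sqrt (by positivity)
  have hdim : Module.finrank ℝ (Fin 2 → ℂ) = 2 * 2 := by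
    simp [Module.finrank_pi_fintype, Complex.finrank_real_complex]
  calc V / 32 / ((n + 3 : ℕ) : ℝ) ^ 2 ≤ V / 32 / ((n + 1 : ℕ) : ℝ) ^ 2 := by gcongr; omega
    _ = volume.real (Metric.ball (0 : Fin 2 → ℂ) r) / 2 := by
        rw [measureReal_def, Measure.addHaar_ball_of_pos _ _ (by positivity), hdim,
          ENNReal.toReal_mul, ENNReal.toReal_ofReal (by positivity), ← measureReal_def, pow_mul, hr]
        push_cast
        field_simp
        ring
    _ ≤ _ := half_mul_volume_ball_le_setIntegral n (by rw [hr]; field_simp; rfl)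

theorem ballWeight_pos {m : ℕ} (hm : 3 ≤ m) : 0 < ballWeight m := by
  obtain ⟨c, hc, h⟩ := exists_le_ballWeight
  exact (div_pos hc (pow_pos (Nat.cast_pos.mpr (three_pos.trans_le hm)) 2)).trans_le (h m hm)

theorem hypVol_ne_zero : hypVol ≠ 0 := fun h => by
  simpa [ballWeight, h] using ballWeight_pos le_rfl

end BallWeight

end HyperbolicVolume

section ReproducingFormula

variable {F : Type*} [NormedAddCommGroup F] [NormedSpace ℂ F]

theorem measurePreserving_smul_of_norm_eq_one {c : ℂ} (hc : ‖c‖ = 1) :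
    MeasurePreserving (fun z : Fin 2 → ℂ => c • z) :=
  volume_preserving_pi (f := fun _ => rotation ⟨c, mem_sphere_zero_iff_norm.mpr hc⟩)
    fun _ => LinearIsometryEquiv.measurePreserving _

theorem measurePreserving_smul_restrict_ballSet {c : ℂ} (hc : ‖c‖ = 1) :
    MeasurePreserving (fun z : Fin 2 → ℂ => c • z) (volume.restrict ballSet)
      (volume.restrict ballSet) := by
  have hpre : (fun z : Fin 2 → ℂ => c • z) ⁻¹' ballSet = ballSet := by
    ext z
    change normSq2 (c • z) < 1 ↔ normSq2 z < 1
    rw [normSq2_smul, hc, one_pow, one_mul]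
  simpa only [hpre] using (measurePreserving_smul_of_norm_eq_one hc).restrict_preimage
    isOpen_ballSet.measurableSet

theorem differentiable_autFactor (g : SU21) : Differentiable ℂ (autFactor g) := fun z =>
  (hasFDerivAt_mulVec_lift3 _ 2 z).differentiableAt

theorem differentiableOn_inv_autFactor_pow_smul {f : (Fin 2 → ℂ) → F}
    (hf : DifferentiableOn ℂ f ballSet) (g : SU21) (m : ℕ) :
    DifferentiableOn ℂ (fun z => (autFactor g z)⁻¹ ^ m • f (fracLin g.1.1 z)) ballSet :=
  (((differentiable_autFactor g).differentiableOn.inv fun z hz =>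
    autFactor_ne_zero g ⟨z, hz⟩).pow m).smul <| hf.comp
      (fun z hz => (hasFDerivAt_fracLin
        (autFactor_ne_zero g ⟨z, hz⟩)).differentiableAt.differentiableWithinAt)
      fun _ hz => fracLin_mem g.2 hz

variable [CompleteSpace F]

theorem integral_one_sub_normSq2_pow_smul {f : (Fin 2 → ℂ) → F}
    (hf : DifferentiableOn ℂ f ballSet) {m : ℕ}
    (hint : Integrable (fun z : Ball2 => (1 - normSq2 z.1) ^ m • f z.1) hypVol) :
    ∫ z : Ball2, (1 - normSq2 z.1) ^ m • f z.1 ∂hypVol = ballWeight m • f 0 := by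
  rw [ballWeight, integral_hypVol fun z => (1 - normSq2 z) ^ m • f z,
    integral_hypVol fun z => (1 - normSq2 z) ^ m]
  simp only [smul_smul, smul_eq_mul]
  refine integral_radial_smul_of_differentiableOn
    (fun c => measurePreserving_smul_restrict_ballSet) isOpen_ballSet balanced_ballSet
    (ae_restrict_mem isOpen_ballSet.measurableSet) hf
    (fun c z hc => by simp only [normSq2_smul, hc, one_pow, one_mul]) ?_
  rw [integrable_hypVol_iff] at hint
  refine (integrableOn_iff_comap_subtypeVal isOpen_ballSet.measurableSet).mpr ?_
  simpa only [smul_smul, Function.comp_def] using hint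

theorem integral_inv_ballPairing_pow_smul {f : (Fin 2 → ℂ) → F}
    (hf : DifferentiableOn ℂ f ballSet) {m : ℕ} (w : Ball2)
    (hint : Integrable (fun z : Ball2 =>
      (1 - normSq2 z.1) ^ m • (ballPairing w.1 z.1)⁻¹ ^ m • f z.1) hypVol) :
    ∫ z : Ball2, (1 - normSq2 z.1) ^ m • (ballPairing w.1 z.1)⁻¹ ^ m • f z.1 ∂hypVol =
      ballWeight m • f w.1 := by
  obtain ⟨g, hg⟩ := exists_smul_ballOrigin w
  have ha : autFactor g 0 ^ m ≠ 0 := pow_ne_zero m (autFactor_ne_zero g ballOrigin)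
  set f₀ : (Fin 2 → ℂ) → F := fun z => (autFactor g z)⁻¹ ^ m • f (fracLin g.1.1 z)
  have hpull (z : Ball2) : (1 - normSq2 (g • z).1) ^ m •
      (ballPairing w.1 (g • z).1)⁻¹ ^ m • f (g • z).1 =
      autFactor g 0 ^ m • (1 - normSq2 z.1) ^ m • f₀ z.1 := by
    have hw := ballPairing_smul_smul g ballOrigin z
    rw [hg, ← star_ballPairing z.1, show ballOrigin.1 = 0 from rfl, ballPairing_zero_right,
      star_one] at hw
    have hz := ballPairing_smul_smul g z z
    rw [ballPairing_self, ballPairing_self] at hz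
    have haz := autFactor_ne_zero g z
    change _ = autFactor g 0 ^ m • (1 - normSq2 z.1) ^ m • (autFactor g z.1)⁻¹ ^ m • f (g • z).1
    simp only [← Complex.coe_smul, smul_smul, Complex.ofReal_pow, ← mul_pow]
    rw [← hz, inv_eq_of_mul_eq_one_left hw]
    congr 2
    field_simp
  have hint₀ : Integrable (fun z : Ball2 => (1 - normSq2 z.1) ^ m • f₀ z.1) hypVol := by
    have h := (measurePreserving_smul g hypVol).integrable_comp_of_integrable hint
    simp only [Function.comp_def, hpull] at h
    exact (integrable_smul_iff ha _).mp h
  rw [← integral_smul_eq_self _ (g := g)]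
  simp only [hpull]
  have hfw : f (fracLin g.1.1 0) = f w.1 := congrArg (fun z : Ball2 => f z.1) hg
  rw [integral_smul, integral_one_sub_normSq2_pow_smul
    (differentiableOn_inv_autFactor_pow_smul hf g m) hint₀, smul_comm, smul_smul,
    inv_pow, mul_inv_cancel₀ ha, one_smul, hfw]

end ReproducingFormula

section HyperbolicDistance

theorem one_le_norm_ballPairing_div_sqrt (z w : Ball2) :
    1 ≤ ‖ballPairing z.1 w.1‖ / √((1 - normSq2 z.1) * (1 - normSq2 w.1)) := by
  have hz := one_sub_normSq2_pos z
  have hw := one_sub_normSq2_pos w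
  rw [one_le_div (by positivity), Real.sqrt_le_iff]
  exact ⟨norm_nonneg _, one_sub_normSq2_mul_le_norm_ballPairing_sq z w⟩

theorem hypDist_eq (z w : Ball2) :
    hypDist z w =
      2 * Real.arcosh (‖ballPairing z.1 w.1‖ / √((1 - normSq2 z.1) * (1 - normSq2 w.1))) := by
  rw [hypDist, herm_lift3, norm_neg]

theorem hypDist_nonneg (z w : Ball2) : 0 ≤ hypDist z w := by
  rw [hypDist_eq]
  exact mul_nonneg two_pos.le (Real.arcosh_nonneg (one_le_norm_ballPairing_div_sqrt z w))

theorem cosh_half_hypDist (z w : Ball2) :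
    Real.cosh (hypDist z w / 2) =
      ‖ballPairing z.1 w.1‖ / √((1 - normSq2 z.1) * (1 - normSq2 w.1)) := by
  rw [hypDist_eq, mul_div_cancel_left₀ _ two_ne_zero,
    Real.cosh_arcosh (one_le_norm_ballPairing_div_sqrt z w)]

theorem cosh_half_hypDist_smul_right (g : SU21) (z w : Ball2) :
    Real.cosh (hypDist z (g • w) / 2) = ‖autFactor g w.1‖ * ‖ballPairing z.1 (g • w).1‖ /
      √((1 - normSq2 z.1) * (1 - normSq2 w.1)) := by
  have hj := norm_pos_iff.mpr (autFactor_ne_zero g w)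
  rw [cosh_half_hypDist, ← one_sub_normSq2_smul g w, mul_left_comm, Real.sqrt_mul (sq_nonneg _),
    Real.sqrt_sq hj.le, mul_div_mul_left _ _ hj.ne']

theorem hypDist_smul_smul (g : SU21) (z w : Ball2) :
    hypDist (g • z) (g • w) = hypDist z w := by
  have hj := norm_pos_iff.mpr (mul_ne_zero (autFactor_ne_zero g z) (autFactor_ne_zero g w))
  rw [hypDist_eq, hypDist_eq, ← ballPairing_smul_smul g z w, ← one_sub_normSq2_smul g z,
    ← one_sub_normSq2_smul g w, mul_mul_mul_comm, ← mul_pow, ← norm_mul,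
    Real.sqrt_mul (sq_nonneg _), Real.sqrt_sq hj.le, norm_mul (_ * _), norm_mul _ (star _),
    norm_star, ← norm_mul, mul_div_mul_left _ _ hj.ne']

theorem norm_autFactor_zero_mul_le_cosh_half_hypDist (g : SU21) (z w : Ball2) :
    ‖autFactor g 0‖ * ((1 - √(normSq2 z.1)) * (1 - √(normSq2 w.1))) ≤
      Real.cosh (hypDist z (g • w) / 2) := by
  have hz := sub_pos.mpr (sqrt_normSq2_lt_one z)
  have hsqrt : √((1 - normSq2 z.1) * (1 - normSq2 w.1)) ≤ 1 :=
    Real.sqrt_le_one.mpr <|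
      mul_le_one₀ (sub_le_self 1 (normSq2_nonneg _)) (one_sub_normSq2_pos w).le
        (sub_le_self 1 (normSq2_nonneg _))
  calc ‖autFactor g 0‖ * ((1 - √(normSq2 z.1)) * (1 - √(normSq2 w.1)))
      = ((1 - √(normSq2 w.1)) * ‖autFactor g 0‖) * (1 - √(normSq2 z.1)) := by ring
    _ ≤ ‖autFactor g w.1‖ * ‖ballPairing z.1 (g • w).1‖ := by
        gcongr
        · exact le_norm_autFactor g w
        · exact one_sub_sqrt_le_norm_ballPairing z (g • w)
    _ ≤ Real.cosh (hypDist z (g • w) / 2) := by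
        rw [cosh_half_hypDist_smul_right]
        refine le_div_self (by positivity) (Real.sqrt_pos.mpr ?_) hsqrt
        exact mul_pos (one_sub_normSq2_pos z) (one_sub_normSq2_pos w)

variable {Γ : Subgroup SU21}

theorem surfDist_nonneg (x y : PicardSurface Γ) : 0 ≤ surfDist Γ x y :=
  Real.sInf_nonneg (by rintro _ ⟨z, w, -, -, rfl⟩; exact hypDist_nonneg z w)

theorem surfDist_le_hypDist_smul (γ : Γ) (z w : Ball2) :
    surfDist Γ (proj Γ z) (proj Γ w) ≤ hypDist z (γ • w) :=
  csInf_le ⟨0, by rintro _ ⟨z, w, -, -, rfl⟩; exact hypDist_nonneg z w⟩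
    ⟨z, γ • w, rfl, Quotient.sound ⟨γ, rfl⟩, rfl⟩

theorem cosh_half_surfDist_le (γ : Γ) (z w : Ball2) :
    Real.cosh (surfDist Γ (proj Γ z) (proj Γ w) / 2) ≤ Real.cosh (hypDist z (γ • w) / 2) := by
  have hnonneg := surfDist_nonneg (proj Γ z) (proj Γ w)
  have hle := surfDist_le_hypDist_smul γ z w
  rw [Real.cosh_le_cosh, abs_of_nonneg (by positivity), abs_of_nonneg (by linarith)]
  linarith

end HyperbolicDistance

section CocompactLattice

variable {Γ : Subgroup SU21}

theorem summable_inv_norm_autFactor_zero_pow [Countable Γ] {F : Set Ball2}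
    (hF : IsFundamentalDomain Γ F hypVol) {n : ℕ} (hn : 6 ≤ n) :
    Summable fun γ : Γ => ‖autFactor γ 0‖⁻¹ ^ n := by
  have hrestrict : (ae (hypVol.restrict F)).NeBot := by
    rw [ae_neBot, Ne, Measure.restrict_eq_zero]
    exact hF.measure_ne_zero hypVol_ne_zero
  obtain ⟨z, hz⟩ := (ae_summable_norm_smul hF (integrable_one_sub_normSq2_pow le_rfl)).exists
  -- `(1 - |γz|²)³ = (1 - |z|²)³ |j(γ, z)|⁻⁶`, which is comparable to `|j(γ, 0)|⁻⁶`.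
  have hterm (γ : Γ) : ‖autFactor γ 0‖⁻¹ ^ 6 ≤
      2 ^ 6 / (1 - normSq2 z.1) ^ 3 * ‖(1 - normSq2 (γ • z).1) ^ 3‖ := by
    have hj := norm_pos_iff.mpr (autFactor_ne_zero γ z)
    have hγz := one_sub_normSq2_pos ((γ : SU21) • z)
    calc ‖autFactor γ 0‖⁻¹ ^ 6 ≤ (2 / ‖autFactor γ z.1‖) ^ 6 := by
          gcongr
          rw [inv_le_comm₀ (one_pos.trans_le (one_le_norm_autFactor_zero _)) (by positivity),
            inv_div, div_le_iff₀' two_pos]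
          exact norm_autFactor_le γ z
      _ = 2 ^ 6 / (1 - normSq2 z.1) ^ 3 * (1 - normSq2 ((γ : SU21) • z).1) ^ 3 := by
          rw [← one_sub_normSq2_smul γ z]
          field_simp
      _ = 2 ^ 6 / (1 - normSq2 z.1) ^ 3 * ‖(1 - normSq2 (γ • z).1) ^ 3‖ := by
          rw [norm_pow]
          exact congrArg (_ * · ^ 3) (Real.norm_of_nonneg hγz.le).symm
  refine (hz.mul_left _).of_nonneg_of_le (fun γ => by positivity) fun γ => (hterm γ).trans' ?_
  exact pow_le_pow_of_le_one (by positivity)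
    (inv_le_one_of_one_le₀ (one_le_norm_autFactor_zero _)) hn

theorem exists_smul_normSq2_le [CompactSpace (PicardSurface Γ)] :
    ∃ r < 1, ∀ z : Ball2, ∃ γ : Γ, normSq2 (γ • z).1 ≤ r := by
  let U (n : ℕ) : Set (PicardSurface Γ) :=
    proj Γ '' {z : Ball2 | normSq2 z.1 < 1 - 1 / ((n : ℝ) + 1)}
  have hopen (n : ℕ) : IsOpen (U n) :=
    isOpenMap_quotient_mk'_mul (Γ := Γ) (T := Ball2) _
      (isOpen_lt (continuous_normSq2.comp continuous_subtype_val) continuous_const)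
  have hcover : Set.univ ⊆ ⋃ n, U n := by
    intro x _
    obtain ⟨z, rfl⟩ := Quotient.exists_rep x
    obtain ⟨n, hn⟩ := exists_nat_one_div_lt (one_sub_normSq2_pos z)
    exact Set.mem_iUnion.mpr ⟨n, z, lt_sub_comm.mp hn, rfl⟩
  have hmono : Monotone U := fun m n hmn =>
    Set.image_mono fun z hz => lt_of_lt_of_le (b := 1 - 1 / ((m : ℝ) + 1)) hz
      (sub_le_sub_left (Nat.one_div_le_one_div hmn) 1)
  obtain ⟨n, hn⟩ := isCompact_univ.elim_directed_cover U hopen hcover hmono.directed_le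
  refine ⟨1 - 1 / ((n : ℝ) + 1), sub_lt_self 1 Nat.one_div_pos_of_nat, fun z => ?_⟩
  obtain ⟨w, hw, hwz⟩ := hn (Set.mem_univ (proj Γ z))
  obtain ⟨γ, rfl⟩ : w ∈ MulAction.orbit Γ z := Quotient.exact hwz
  exact ⟨γ, le_of_lt hw⟩

theorem inv_cosh_half_hypDist_pow_le {r : ℝ} (hr : r < 1) {z w : Ball2}
    (hz : normSq2 z.1 ≤ r) (hw : normSq2 w.1 ≤ r) (g : SU21) (n : ℕ) :
    (Real.cosh (hypDist z (g • w) / 2))⁻¹ ^ n ≤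
      ‖autFactor g 0‖⁻¹ ^ n * ((1 - √r) ^ 2)⁻¹ ^ n := by
  have hpos : 0 < 1 - √r := sub_pos.mpr ((Real.sqrt_lt' one_pos).mpr (by rwa [one_pow]))
  have hj : 0 < ‖autFactor g 0‖ := one_pos.trans_le (one_le_norm_autFactor_zero g)
  rw [← mul_pow, ← mul_inv, sq]
  gcongr
  refine le_trans ?_ (norm_autFactor_zero_mul_le_cosh_half_hypDist g z w)
  gcongr
  exact (sub_pos.mpr (sqrt_normSq2_lt_one z)).le

theorem exists_tsum_inv_cosh_half_hypDist_le [CompactSpace (PicardSurface Γ)] {n : ℕ}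
    (hs : Summable fun γ : Γ => ‖autFactor γ 0‖⁻¹ ^ n) :
    ∃ C, ∀ z w : Ball2, (Summable fun γ : Γ => (Real.cosh (hypDist z (γ • w) / 2))⁻¹ ^ n) ∧
      ∑' γ : Γ, (Real.cosh (hypDist z (γ • w) / 2))⁻¹ ^ n ≤ C := by
  obtain ⟨r, hr1, hr⟩ := exists_smul_normSq2_le (Γ := Γ)
  refine ⟨∑' γ : Γ, ‖autFactor γ 0‖⁻¹ ^ n * ((1 - √r) ^ 2)⁻¹ ^ n, fun z w => ?_⟩
  obtain ⟨α, hα⟩ := hr z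
  obtain ⟨β, hβ⟩ := hr w
  let a (γ : Γ) : ℝ := (Real.cosh (hypDist (α • z) (γ • β • w) / 2))⁻¹ ^ n
  let e : Γ ≃ Γ := (Equiv.mulLeft α).trans (Equiv.mulRight β⁻¹)
  have hreindex : (fun γ : Γ => (Real.cosh (hypDist z (γ • w) / 2))⁻¹ ^ n) = a ∘ e := by
    funext γ
    have he : e γ • β • w = α • γ • w := by simp [e, mul_smul]
    simp only [Function.comp_apply, a, he]
    exact congrArg (fun d => (Real.cosh (d / 2))⁻¹ ^ n)
      (hypDist_smul_smul (α : SU21) z (γ • w)).symm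
  have hle (γ : Γ) : a γ ≤ ‖autFactor γ 0‖⁻¹ ^ n * ((1 - √r) ^ 2)⁻¹ ^ n :=
    inv_cosh_half_hypDist_pow_le hr1 hα hβ γ n
  have hdom := hs.mul_right (((1 - √r) ^ 2)⁻¹ ^ n)
  have hsum : Summable a := hdom.of_nonneg_of_le (fun γ => by positivity) hle
  rw [hreindex]
  exact ⟨e.summable_iff.mpr hsum, (e.tsum_eq a).trans_le (hsum.tsum_le_tsum hle hdom)⟩

theorem exists_norm_sq_mul_le_of_automorphic [CompactSpace (PicardSurface Γ)]
    {f : (Fin 2 → ℂ) → ℂ} (hf : ContinuousOn f ballSet) {m : ℕ}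
    (hinv : ∀ (γ : Γ) (z : Ball2), f (γ • z).1 = autFactor γ z.1 ^ m * f z.1) :
    ∃ M, ∀ z : Ball2, ‖f z.1‖ ^ 2 * (1 - normSq2 z.1) ^ m ≤ M := by
  obtain ⟨r, hr1, hr⟩ := exists_smul_normSq2_le (Γ := Γ)
  have hsub : {z | normSq2 z ≤ r} ⊆ ballSet := fun z hz => lt_of_le_of_lt hz hr1
  have hcompact : IsCompact {z | normSq2 z ≤ r} :=
    (isCompact_closedBall (0 : Fin 2 → ℂ) 1).of_isClosed_subset
      (isClosed_le continuous_normSq2 continuous_const) fun z hz =>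
        mem_closedBall_zero_iff.mpr (norm_le_one_of_mem_ballSet (hsub hz))
  obtain ⟨M, hM⟩ := hcompact.exists_bound_of_continuousOn
    (f := fun z => ‖f z‖ ^ 2 * (1 - normSq2 z) ^ m) (((hf.mono hsub).norm.pow 2).mul
      ((continuous_const.sub continuous_normSq2).pow m).continuousOn)
  have hinvariant (γ : Γ) (z : Ball2) :
      ‖f (γ • z).1‖ ^ 2 * (1 - normSq2 (γ • z).1) ^ m = ‖f z.1‖ ^ 2 * (1 - normSq2 z.1) ^ m := by
    rw [hinv, ← one_sub_normSq2_smul γ z, norm_mul, norm_pow, mul_pow, mul_pow, pow_right_comm,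
      mul_left_comm, mul_assoc]
    rfl
  refine ⟨M, fun z => ?_⟩
  obtain ⟨γ, hγ⟩ := hr z
  exact (hinvariant γ z).symm.trans_le ((le_abs_self _).trans (hM _ hγ))

end CocompactLattice

section BallPairingDerivative

/-- The derivative of the affine map `z ↦ ballPairing z w`. -/
noncomputable def ballPairingDeriv (w : Fin 2 → ℂ) : (Fin 2 → ℂ) →L[ℂ] ℂ :=
  -(star (w 0) • ContinuousLinearMap.proj 0 + star (w 1) • ContinuousLinearMap.proj 1)

theorem ballPairing_eq_one_add (z w : Fin 2 → ℂ) :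
    ballPairing z w = 1 + ballPairingDeriv w z := by
  simp only [ballPairing, ballPairingDeriv, neg_apply, add_apply, smul_apply,
    ContinuousLinearMap.proj_apply, smul_eq_mul]
  ring

theorem hasFDerivAt_ballPairing (z w : Fin 2 → ℂ) :
    HasFDerivAt (ballPairing · w) (ballPairingDeriv w) z := by
  simp only [ballPairing_eq_one_add]
  exact (ballPairingDeriv w).hasFDerivAt.const_add 1

theorem norm_ballPairingDeriv_le {w : Fin 2 → ℂ} (hw : w ∈ ballSet) :
    ‖ballPairingDeriv w‖ ≤ 2 := by
  refine ContinuousLinearMap.opNorm_le_bound _ two_pos.le fun z => ?_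
  have hcoord (i : Fin 2) : ‖star (w i) * z i‖ ≤ ‖z‖ := by
    rw [norm_mul, norm_star]
    exact (mul_le_of_le_one_left (norm_nonneg _)
      ((norm_le_pi_norm w i).trans (norm_le_one_of_mem_ballSet hw))).trans (norm_le_pi_norm z i)
  calc ‖-(star (w 0) * z 0 + star (w 1) * z 1)‖ ≤ ‖star (w 0) * z 0‖ + ‖star (w 1) * z 1‖ := by
        rw [norm_neg]
        exact norm_add_le _ _
    _ ≤ 2 * ‖z‖ := by linarith [hcoord 0, hcoord 1]

theorem le_norm_ballPairing_of_mem_ball {z₀ : Ball2} {z : Fin 2 → ℂ}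
    (hz : z ∈ Metric.ball z₀.1 ((1 - √(normSq2 z₀.1)) / 4)) (w : Ball2) :
    (1 - √(normSq2 z₀.1)) / 2 ≤ ‖ballPairing z w.1‖ := by
  rw [mem_ball_iff_norm'] at hz
  have hdiff : ‖ballPairing z₀.1 w.1 - ballPairing z w.1‖ ≤ 2 * ‖z₀.1 - z‖ := by
    rw [ballPairing_eq_one_add, ballPairing_eq_one_add, add_sub_add_left_eq_sub, ← map_sub]
    exact (ballPairingDeriv w.1).le_of_opNorm_le (norm_ballPairingDeriv_le w.2) _
  linarith [one_sub_sqrt_le_norm_ballPairing z₀ w,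
    norm_sub_norm_le (ballPairing z₀.1 w.1) (ballPairing z w.1)]

end BallPairingDerivative

section PoincareSeries

/-- The term of `g` in the Poincaré series of weight `m` based at `w`. -/
noncomputable def poincareTerm (m : ℕ) (w : Ball2) (g : SU21) (z : Fin 2 → ℂ) : ℂ :=
  (star (autFactor g w.1) * ballPairing z (g • w).1)⁻¹ ^ m

/-- The Poincaré series of weight `m` based at `w`, a multiple of the reproducing kernel of the
forms of weight `m` on `Γ \ 𝔹²`. -/
noncomputable def poincareSeries (Γ : Subgroup SU21) (m : ℕ) (w : Ball2) (z : Fin 2 → ℂ) : ℂ :=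
  ∑' γ : Γ, poincareTerm m w γ z

theorem poincareTerm_mul_smul (m : ℕ) (w : Ball2) (g h : SU21) (z : Ball2) :
    poincareTerm m w (g * h) (g • z).1 = autFactor g z.1 ^ m * poincareTerm m w h z.1 := by
  have hj := autFactor_ne_zero g z
  have hj' := star_ne_zero.mpr (autFactor_ne_zero g (h • w))
  simp only [poincareTerm]
  rw [← ballPairing_smul_smul g z (h • w), autFactor_mul, star_mul', mul_smul, ← mul_pow]
  congr 1
  field_simp

theorem norm_poincareTerm_mul_sqrt (m : ℕ) (w : Ball2) (g : SU21) (z : Ball2) :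
    ‖poincareTerm m w g z.1‖ * (√((1 - normSq2 z.1) ^ m) * √((1 - normSq2 w.1) ^ m)) =
      (Real.cosh (hypDist z (g • w) / 2))⁻¹ ^ m := by
  have hz := one_sub_normSq2_pos z
  have hw := one_sub_normSq2_pos w
  have hsqrt (x : ℝ) (hx : 0 < x) : √(x ^ m) = √x ^ m := by
    rw [Real.sqrt_eq_iff_eq_sq (by positivity) (by positivity), pow_right_comm,
      Real.sq_sqrt hx.le]
  rw [cosh_half_hypDist_smul_right, inv_div, poincareTerm, norm_pow, norm_inv, norm_mul, norm_star,
    hsqrt _ hz, hsqrt _ hw, ← mul_pow, ← mul_pow, ← Real.sqrt_mul hz.le, inv_mul_eq_div]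

theorem norm_poincareTerm_le {c : ℝ} (hc : 0 < c) {z : Fin 2 → ℂ} (m : ℕ) {w : Ball2} {g : SU21}
    (hz : c ≤ ‖ballPairing z (g • w).1‖) :
    ‖poincareTerm m w g z‖ ≤
      ‖autFactor g 0‖⁻¹ ^ m * ((1 - √(normSq2 w.1))⁻¹ ^ m * c⁻¹ ^ m) := by
  have hw := sub_pos.mpr (sqrt_normSq2_lt_one w)
  have hj := one_pos.trans_le (one_le_norm_autFactor_zero g)
  rw [poincareTerm, norm_pow, norm_inv, norm_mul, norm_star, ← mul_pow, ← mul_pow, ← mul_inv,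
    ← mul_inv]
  gcongr ?_⁻¹ ^ m
  calc ‖autFactor g 0‖ * ((1 - √(normSq2 w.1)) * c)
      = (1 - √(normSq2 w.1)) * ‖autFactor g 0‖ * c := by ring
    _ ≤ ‖autFactor g w.1‖ * ‖ballPairing z (g • w).1‖ := by
        gcongr
        exact le_norm_autFactor g w

theorem hasFDerivAt_poincareTerm (m : ℕ) (w : Ball2) (g : SU21) {z : Fin 2 → ℂ}
    (hz : ballPairing z (g • w).1 ≠ 0) :
    HasFDerivAt (poincareTerm m w g)
      (-(m * poincareTerm m w g z * (ballPairing z (g • w).1)⁻¹) • ballPairingDeriv (g • w).1)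
      z := by
  have hj := star_ne_zero.mpr (autFactor_ne_zero g w)
  have h := (((hasDerivAt_inv (mul_ne_zero hj hz)).pow m).comp_hasFDerivAt z
    ((hasFDerivAt_ballPairing z (g • w).1).const_mul (star (autFactor g w.1))))
  refine h.congr_fderiv ?_
  rw [smul_smul]
  congr 1
  rcases m with _ | m
  · simp
  · simp only [poincareTerm, Nat.add_sub_cancel, pow_succ]
    field_simp

variable {Γ : Subgroup SU21}

theorem poincareSeries_smul (m : ℕ) (w : Ball2) (γ : Γ) (z : Ball2) :
    poincareSeries Γ m w (γ • z).1 = autFactor γ z.1 ^ m * poincareSeries Γ m w z.1 := by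
  rw [poincareSeries, poincareSeries, ← tsum_mul_left, ← (Equiv.mulLeft γ).tsum_eq]
  exact tsum_congr fun δ => poincareTerm_mul_smul m w γ δ z

theorem differentiableOn_poincareSeries {m : ℕ}
    (hs : Summable fun γ : Γ => ‖autFactor γ 0‖⁻¹ ^ m) (w : Ball2) :
    DifferentiableOn ℂ (poincareSeries Γ m w) ballSet := by
  intro z₀ hz₀
  set ρ : ℝ := 1 - √(normSq2 z₀)
  have hρ : 0 < ρ := sub_pos.mpr (sqrt_normSq2_lt_one ⟨z₀, hz₀⟩)
  have hpairing (z : Fin 2 → ℂ) (hz : z ∈ Metric.ball z₀ (ρ / 4)) (u : Ball2) :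
      ρ / 2 ≤ ‖ballPairing z u.1‖ := le_norm_ballPairing_of_mem_ball (z₀ := ⟨z₀, hz₀⟩) hz u
  have hmem : z₀ ∈ Metric.ball z₀ (ρ / 4) := Metric.mem_ball_self (by positivity)
  set A : ℝ := (1 - √(normSq2 w.1))⁻¹ ^ m * (ρ / 2)⁻¹ ^ m
  have hterm (γ : Γ) (z) (hz : z ∈ Metric.ball z₀ (ρ / 4)) :
      ‖poincareTerm m w γ z‖ ≤ ‖autFactor γ 0‖⁻¹ ^ m * A :=
    norm_poincareTerm_le (half_pos hρ) m (hpairing z hz _)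
  have hsum : Summable fun γ : Γ => poincareTerm m w γ z₀ :=
    (hs.mul_right A).of_norm_bounded fun γ => hterm γ z₀ hmem
  refine (hasFDerivAt_tsum_of_isPreconnected ((hs.mul_right A).mul_left (m * (ρ / 2)⁻¹ * 2))
    Metric.isOpen_ball (convex_ball z₀ (ρ / 4)).isPreconnected
    (fun (γ : Γ) z hz => hasFDerivAt_poincareTerm m w γ
      (norm_pos_iff.mp ((half_pos hρ).trans_le (hpairing z hz _)))) (fun γ z hz => ?_) hmem
    hsum hmem).differentiableAt.differentiableWithinAt
  rw [norm_smul, norm_neg, norm_mul, norm_mul, Complex.norm_natCast, norm_inv]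
  calc _ ≤ m * (‖autFactor γ 0‖⁻¹ ^ m * A) * (ρ / 2)⁻¹ * 2 := by
        have hnonneg := (norm_nonneg _).trans (hterm γ z hz)
        gcongr
        · exact hterm γ z hz
        · exact hpairing z hz _
        · exact norm_ballPairingDeriv_le ((γ : SU21) • w).2
    _ = _ := by ring

end PoincareSeries

section ReproducingProperty

variable {Γ : Subgroup SU21} {m : ℕ} {f : (Fin 2 → ℂ) → ℂ}

theorem integrable_inv_ballPairing_pow_smul (hf : ContinuousOn f ballSet) (hm : 6 ≤ m) {M : ℝ}
    (hM : ∀ z : Ball2, ‖f z.1‖ ^ 2 * (1 - normSq2 z.1) ^ m ≤ M) (w : Ball2) :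
    Integrable (fun z : Ball2 =>
      (1 - normSq2 z.1) ^ m • (ballPairing w.1 z.1)⁻¹ ^ m • f z.1) hypVol := by
  have hw := sub_pos.mpr (sqrt_normSq2_lt_one w)
  have hnormSq : Continuous fun z : Ball2 => 1 - normSq2 z.1 :=
    continuous_const.sub (continuous_normSq2.comp continuous_subtype_val)
  have hpairing : Continuous (ballPairing w.1) := by
    unfold ballPairing
    fun_prop
  refine integrable_hypVol_of_norm_le (M := (1 - √(normSq2 w.1))⁻¹ ^ m * √M)
    ((hnormSq.pow m).smul ((((hpairing.comp continuous_subtype_val).inv₀ fun z =>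
      ballPairing_ne_zero w z).pow m).smul hf.domRestrict)) fun z => ?_
  have hz := one_sub_normSq2_pos z
  have hfz : ‖f z.1‖ * (1 - normSq2 z.1) ^ (m - 3) ≤ √M := by
    refine Real.le_sqrt_of_sq_le (le_trans ?_ (hM z))
    rw [mul_pow, ← pow_mul]
    gcongr ?_ * ?_
    exact pow_le_pow_of_le_one hz.le (sub_le_self 1 (normSq2_nonneg _)) (by omega)
  rw [norm_smul, norm_smul, norm_pow, norm_pow, norm_inv, Real.norm_of_nonneg hz.le]
  calc (1 - normSq2 z.1) ^ m * (‖ballPairing w.1 z.1‖⁻¹ ^ m * ‖f z.1‖)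
      = ‖ballPairing w.1 z.1‖⁻¹ ^ m * (‖f z.1‖ * (1 - normSq2 z.1) ^ (m - 3)) *
          (1 - normSq2 z.1) ^ 3 := by
        rw [← pow_sub_mul_pow _ (by omega : 3 ≤ m)]
        ring
    _ ≤ (1 - √(normSq2 w.1))⁻¹ ^ m * √M * (1 - normSq2 z.1) ^ 3 := by
        gcongr
        exact one_sub_sqrt_le_norm_ballPairing w z

theorem one_sub_normSq2_pow_smul_inv_smul {g : SU21} {z : Ball2}
    (hg : f (g⁻¹ • z).1 = autFactor g⁻¹ z.1 ^ m * f z.1) (w : Ball2) :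
    (1 - normSq2 (g⁻¹ • z).1) ^ m • (ballPairing w.1 (g⁻¹ • z).1)⁻¹ ^ m • f (g⁻¹ • z).1 =
      f z.1 * star (poincareTerm m w g z.1) * (((1 - normSq2 z.1) ^ m : ℝ) : ℂ) := by
  have hj := autFactor_ne_zero g⁻¹ z
  have hj' := star_ne_zero.mpr hj
  have hB := ballPairing_ne_zero w (g⁻¹ • z)
  have hpairing := autFactor_eq_star_mul_ballPairing g⁻¹ z w
  rw [inv_inv] at hpairing
  have hself := ballPairing_smul_smul g⁻¹ z z
  rw [ballPairing_self, ballPairing_self] at hself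
  rw [hg, poincareTerm, ← hpairing, star_pow, star_inv₀, star_mul', star_ballPairing,
    ← Complex.coe_smul, Complex.ofReal_pow, Complex.ofReal_pow, ← hself]
  simp only [smul_eq_mul, mul_pow, mul_inv, inv_pow]
  field_simp

theorem setIntegral_mul_star_poincareSeries [Countable Γ] {F : Set Ball2}
    (hF : IsFundamentalDomain Γ F hypVol) (hf : DifferentiableOn ℂ f ballSet) (hm : 6 ≤ m) {M : ℝ}
    (hM : ∀ z : Ball2, ‖f z.1‖ ^ 2 * (1 - normSq2 z.1) ^ m ≤ M)
    (hinv : ∀ (γ : Γ) (z : Ball2), f (γ • z).1 = autFactor γ z.1 ^ m * f z.1) (w : Ball2) :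
    ∫ z in F, f z.1 * star (poincareSeries Γ m w z.1) * (((1 - normSq2 z.1) ^ m : ℝ) : ℂ) ∂hypVol =
      f w.1 * ballWeight m := by
  have hint := integrable_inv_ballPairing_pow_smul hf.continuousOn hm hM w
  have hterm (γ : Γ) (z : Ball2) : (1 - normSq2 (γ⁻¹ • z).1) ^ m •
      (ballPairing w.1 (γ⁻¹ • z).1)⁻¹ ^ m • f (γ⁻¹ • z).1 =
      f z.1 * star (poincareTerm m w γ z.1) * (((1 - normSq2 z.1) ^ m : ℝ) : ℂ) :=
    one_sub_normSq2_pow_smul_inv_smul (hinv γ⁻¹ z) w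
  calc ∫ z in F, f z.1 * star (poincareSeries Γ m w z.1) * (((1 - normSq2 z.1) ^ m : ℝ) : ℂ) ∂hypVol
      = ∫ z in F, ∑' γ : Γ, (1 - normSq2 (γ⁻¹ • z).1) ^ m •
          (ballPairing w.1 (γ⁻¹ • z).1)⁻¹ ^ m • f (γ⁻¹ • z).1 ∂hypVol := by
        simp only [hterm, tsum_mul_right, tsum_mul_left, poincareSeries, tsum_star]
    _ = ∫ z : Ball2, (1 - normSq2 z.1) ^ m • (ballPairing w.1 z.1)⁻¹ ^ m • f z.1 ∂hypVol :=
        setIntegral_tsum_inv_smul hF hint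
    _ = f w.1 * ballWeight m := by
        rw [integral_inv_ballPairing_pow_smul hf w hint, Complex.real_smul, mul_comm]

end ReproducingProperty

section BergmanKernel

variable {Γ : Subgroup SU21} {k d : ℕ} {F : Set Ball2} {b : Module.Basis (Fin d) ℂ (H0 Γ k)}

/-- The Poincaré series of weight `3k` based at `w`, as a section of the `k`-th power of the
canonical bundle. -/
noncomputable def poincareSection (hs : Summable fun γ : Γ => ‖autFactor γ 0‖⁻¹ ^ (3 * k))
    (w : Ball2) : H0 Γ k :=
  ⟨fun z => poincareSeries Γ (3 * k) w z.1 • dzFrame k, mem_H0_iff.mpr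
    ⟨_, differentiableOn_poincareSeries hs w, fun _ => rfl, poincareSeries_smul (3 * k) w⟩⟩

theorem coeffDz_poincareSection (hs : Summable fun γ : Γ => ‖autFactor γ 0‖⁻¹ ^ (3 * k))
    (w z : Ball2) :
    coeffDz k ((poincareSection hs w).1 z) = poincareSeries Γ (3 * k) w z.1 :=
  coeffDz_smul_dzFrame k _

theorem l2Inner_poincareSection [Countable Γ] [CompactSpace (PicardSurface Γ)]
    (hF : IsFundamentalDomain Γ F hypVol) (hk : 2 ≤ k)
    (hs : Summable fun γ : Γ => ‖autFactor γ 0‖⁻¹ ^ (3 * k)) (w : Ball2) (η : H0 Γ k) :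
    l2Inner F k η.1 (poincareSection hs w).1 = coeffDz k (η.1 w) * ballWeight (3 * k) := by
  obtain ⟨f, hf, hη, hinv⟩ := mem_H0_iff.mp η.2
  obtain ⟨M, hM⟩ := exists_norm_sq_mul_le_of_automorphic hf.continuousOn hinv
  rw [hη, coeffDz_smul_dzFrame,
    ← setIntegral_mul_star_poincareSeries hF hf (by omega) hM hinv w, l2Inner]
  simp only [hη, poincareSection, fibreInner_smul_dzFrame]

theorem continuous_coeffDz {ω : Ball2 → PluriFibre k} (h : ω ∈ H0 Γ k) :
    Continuous fun z => coeffDz k (ω z) := by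
  obtain ⟨f, hf, hω, -⟩ := mem_H0_iff.mp h
  simp only [hω, coeffDz_smul_dzFrame]
  exact hf.continuousOn.domRestrict

theorem continuous_fibreInner {ω η : Ball2 → PluriFibre k} (hω : ω ∈ H0 Γ k) (hη : η ∈ H0 Γ k) :
    Continuous fun z => fibreInner k z (ω z) (η z) := by
  simp only [fibreInner, frameNormSq_eq]
  exact ((continuous_coeffDz hω).mul (continuous_coeffDz hη).star).mul
    (Complex.continuous_ofReal.comp
      ((continuous_const.sub (continuous_normSq2.comp continuous_subtype_val)).pow _))

theorem norm_fibreInner_le (z : Ball2) (a b : PluriFibre k) :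
    ‖fibreInner k z a b‖ ≤ ‖fibreInner k z a a‖ + ‖fibreInner k z b b‖ := by
  simp only [fibreInner, norm_mul, norm_star, ← add_mul]
  gcongr
  nlinarith only [sq_nonneg (‖coeffDz k a‖ - ‖coeffDz k b‖), sq_nonneg ‖coeffDz k a‖,
    sq_nonneg ‖coeffDz k b‖]

theorem IsL2Orthonormal.integrable_fibreInner (hb : IsL2Orthonormal F b) (i j : Fin d) :
    Integrable (fun z => fibreInner k z ((b i).1 z) ((b j).1 z)) (hypVol.restrict F) := by
  have hself (i : Fin d) :
      Integrable (fun z => fibreInner k z ((b i).1 z) ((b i).1 z)) (hypVol.restrict F) := by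
    -- A non-integrable function has Bochner integral `0`, whereas this integral is `1`.
    refine not_imp_comm.mp integral_undef ?_
    rw [← l2Inner, hb i i, if_pos rfl]
    exact one_ne_zero
  exact ((hself i).norm.add (hself j).norm).mono'
    (continuous_fibreInner (b i).2 (b j).2).aestronglyMeasurable
    (Filter.Eventually.of_forall fun z => norm_fibreInner_le z _ _)

theorem coeffDz_eq_sum_repr (b : Module.Basis (Fin d) ℂ (H0 Γ k)) (η : H0 Γ k) (z : Ball2) :
    coeffDz k (η.1 z) = ∑ j, b.repr η j * coeffDz k ((b j).1 z) := by
  let evalCoeff : H0 Γ k →ₗ[ℂ] ℂ := coeffDz k ∘ₗ LinearMap.proj z ∘ₗ (H0 Γ k).subtype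
  have h := congrArg evalCoeff (b.sum_repr η)
  simp only [map_sum, map_smul] at h
  exact h.symm

theorem IsL2Orthonormal.l2Inner_eq_star_repr (hb : IsL2Orthonormal F b) (i : Fin d)
    (η : H0 Γ k) : l2Inner F k (b i).1 η.1 = star (b.repr η i) := by
  have hexpand (z : Ball2) : fibreInner k z ((b i).1 z) (η.1 z) =
      ∑ j, star (b.repr η j) * fibreInner k z ((b i).1 z) ((b j).1 z) := by
    simp only [fibreInner]
    rw [coeffDz_eq_sum_repr b η z, star_sum, Finset.mul_sum, Finset.sum_mul]
    refine Finset.sum_congr rfl fun j _ => ?_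
    rw [star_mul']
    ring
  calc l2Inner F k (b i).1 η.1
      = ∑ j, star (b.repr η j) * l2Inner F k (b i).1 (b j).1 := by
        simp only [l2Inner, hexpand]
        rw [integral_finsetSum _ fun j _ => (hb.integrable_fibreInner i j).const_mul _]
        simp only [integral_const_mul]
    _ = star (b.repr η i) := by
        simp only [hb i, mul_ite, mul_one, mul_zero, Finset.sum_ite_eq, Finset.mem_univ, if_true]

theorem ballWeight_mul_bergmanKernel [Countable Γ] [CompactSpace (PicardSurface Γ)]
    (hF : IsFundamentalDomain Γ F hypVol) (hk : 2 ≤ k)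
    (hs : Summable fun γ : Γ => ‖autFactor γ 0‖⁻¹ ^ (3 * k)) (hb : IsL2Orthonormal F b)
    (z w : Ball2) :
    ballWeight (3 * k) * bergmanKernel b z w = poincareSeries Γ (3 * k) w z.1 := by
  have hrepr (j : Fin d) : b.repr (poincareSection hs w) j =
      star (coeffDz k ((b j).1 w)) * ballWeight (3 * k) := by
    rw [← star_star (b.repr _ j), ← hb.l2Inner_eq_star_repr, l2Inner_poincareSection hF hk hs,
      star_mul', Complex.star_def, Complex.conj_ofReal]
  rw [← coeffDz_poincareSection hs, coeffDz_eq_sum_repr b, bergmanKernel, Finset.mul_sum]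
  refine Finset.sum_congr rfl fun j _ => ?_
  rw [hrepr]
  ring

theorem norm_poincareSeries_mul_sqrt_le {m n : ℕ} (hn : n ≤ m) (z w : Ball2)
    (hs : Summable fun γ : Γ => (Real.cosh (hypDist z (γ • w) / 2))⁻¹ ^ n) :
    ‖poincareSeries Γ m w z.1‖ * (√((1 - normSq2 z.1) ^ m) * √((1 - normSq2 w.1) ^ m)) ≤
      (Real.cosh (surfDist Γ (proj Γ z) (proj Γ w) / 2))⁻¹ ^ (m - n) *
        ∑' γ : Γ, (Real.cosh (hypDist z (γ • w) / 2))⁻¹ ^ n := by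
  set A := √((1 - normSq2 z.1) ^ m) * √((1 - normSq2 w.1) ^ m)
  set S := Real.cosh (surfDist Γ (proj Γ z) (proj Γ w) / 2)
  have hA : 0 < A := mul_pos (Real.sqrt_pos.mpr (pow_pos (one_sub_normSq2_pos z) m))
    (Real.sqrt_pos.mpr (pow_pos (one_sub_normSq2_pos w) m))
  have hterm (γ : Γ) : ‖poincareTerm m w γ z.1‖ * A ≤
      S⁻¹ ^ (m - n) * (Real.cosh (hypDist z (γ • w) / 2))⁻¹ ^ n := by
    calc ‖poincareTerm m w γ z.1‖ * A = (Real.cosh (hypDist z (γ • w) / 2))⁻¹ ^ m :=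
          norm_poincareTerm_mul_sqrt m w γ z
      _ = (Real.cosh (hypDist z (γ • w) / 2))⁻¹ ^ (m - n) *
          (Real.cosh (hypDist z (γ • w) / 2))⁻¹ ^ n := (pow_sub_mul_pow _ hn).symm
      _ ≤ S⁻¹ ^ (m - n) * (Real.cosh (hypDist z (γ • w) / 2))⁻¹ ^ n := by
          gcongr
          exact cosh_half_surfDist_le γ z w
  have hdom := hs.mul_left (S⁻¹ ^ (m - n))
  have hsum : Summable fun γ : Γ => ‖poincareTerm m w γ z.1‖ * A :=
    hdom.of_nonneg_of_le (fun γ => by positivity) hterm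
  calc ‖poincareSeries Γ m w z.1‖ * A ≤ (∑' γ : Γ, ‖poincareTerm m w γ z.1‖) * A := by
        gcongr
        exact norm_tsum_le_tsum_norm ((summable_mul_right_iff hA.ne').mp hsum)
    _ = ∑' γ : Γ, ‖poincareTerm m w γ z.1‖ * A := tsum_mul_right.symm
    _ ≤ ∑' γ : Γ, S⁻¹ ^ (m - n) * (Real.cosh (hypDist z (γ • w) / 2))⁻¹ ^ n :=
        hsum.tsum_le_tsum hterm hdom
    _ = S⁻¹ ^ (m - n) * ∑' γ : Γ, (Real.cosh (hypDist z (γ • w) / 2))⁻¹ ^ n := tsum_mul_left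

theorem ballWeight_mul_bergmanNorm_le [Countable Γ] [CompactSpace (PicardSurface Γ)]
    (hF : IsFundamentalDomain Γ F hypVol) (hk : 2 ≤ k) (hb : IsL2Orthonormal F b) {n : ℕ}
    (hn : n ≤ 3 * k) (z w : Ball2)
    (hs : Summable fun γ : Γ => (Real.cosh (hypDist z (γ • w) / 2))⁻¹ ^ n) :
    ballWeight (3 * k) * bergmanNorm b z w ≤
      (Real.cosh (surfDist Γ (proj Γ z) (proj Γ w) / 2))⁻¹ ^ (3 * k - n) *
        ∑' γ : Γ, (Real.cosh (hypDist z (γ • w) / 2))⁻¹ ^ n := by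
  refine le_trans (le_of_eq ?_) (norm_poincareSeries_mul_sqrt_le hn z w hs)
  rw [← ballWeight_mul_bergmanKernel hF hk
      (summable_inv_norm_autFactor_zero_pow hF (by omega)) hb z w,
    norm_mul, Complex.norm_of_nonneg (ballWeight_pos (by omega)).le, bergmanNorm, frameNormSq_eq,
    frameNormSq_eq, mul_assoc]

end BergmanKernel

theorem theorem1_general (Γ : Subgroup SU21) [Countable Γ] [CompactSpace (PicardSurface Γ)]
    {n : ℕ} (hn : 6 ≤ n) :
    ∃ C : ℝ, ∀ F : Set Ball2, IsFundamentalDomain Γ F hypVol →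
      ∀ k : ℕ, n ≤ 3 * k →
        ∀ (d : ℕ) (b : Module.Basis (Fin d) ℂ (H0 Γ k)), IsL2Orthonormal F b →
          ∀ z w : Ball2,
            bergmanNorm b z w ≤
              C * ((k : ℝ) ^ 2 /
                Real.cosh (surfDist Γ (proj Γ z) (proj Γ w) / 2) ^ (3 * k - n)) := by
  -- The constant is chosen before `F`; when this series diverges there is no `F`.
  by_cases hs : Summable fun γ : Γ => ‖autFactor γ 0‖⁻¹ ^ n
  swap
  · exact ⟨0, fun F hF => absurd (summable_inv_norm_autFactor_zero_pow hF hn) hs⟩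
  obtain ⟨A, hA⟩ := exists_tsum_inv_cosh_half_hypDist_le hs
  obtain ⟨c, hc, hweight⟩ := exists_le_ballWeight
  refine ⟨9 * A / c, fun F hF k hk d b hb z w => ?_⟩
  set S := Real.cosh (surfDist Γ (proj Γ z) (proj Γ w) / 2)
  have hS : 0 < S := Real.cosh_pos _
  have hk0 : (0 : ℝ) < k := by exact_mod_cast (by omega : 0 < k)
  have hnorm : 0 ≤ bergmanNorm b z w := by unfold bergmanNorm; positivity
  have hbound : c / (3 * k : ℕ) ^ 2 * bergmanNorm b z w ≤ S⁻¹ ^ (3 * k - n) * A :=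
    calc c / (3 * k : ℕ) ^ 2 * bergmanNorm b z w ≤ ballWeight (3 * k) * bergmanNorm b z w := by
          gcongr
          exact hweight _ (by omega)
      _ ≤ S⁻¹ ^ (3 * k - n) * ∑' γ : Γ, (Real.cosh (hypDist z (γ • w) / 2))⁻¹ ^ n :=
          ballWeight_mul_bergmanNorm_le hF (by omega) hb hk z w (hA z w).1
      _ ≤ S⁻¹ ^ (3 * k - n) * A := by
          gcongr
          exact (hA z w).2
  calc bergmanNorm b z w
      = 9 * k ^ 2 / c * (c / (3 * k : ℕ) ^ 2 * bergmanNorm b z w) := by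
        push_cast
        field_simp
        norm_num
    _ ≤ 9 * k ^ 2 / c * (S⁻¹ ^ (3 * k - n) * A) := by gcongr
    _ = 9 * A / c * (k ^ 2 / S ^ (3 * k - n)) := by
        rw [inv_pow]
        field_simp

theorem theorem1 (Γ : Subgroup SU21)
    (hdiscrete : DiscreteTopology Γ)
    (htorsionfree : ∀ γ : Γ, γ ≠ 1 → ¬ IsOfFinOrder γ)
    (hcompact : CompactSpace (PicardSurface Γ)) :
    ∃ C : ℝ, ∀ F : Set Ball2, MeasureTheory.IsFundamentalDomain Γ F hypVol →
      ∀ k : ℕ, 3 ≤ k →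
        ∀ (d : ℕ) (b : Module.Basis (Fin d) ℂ (H0 Γ k)), IsL2Orthonormal F b →
          ∀ z w : Ball2,
            bergmanNorm b z w ≤
              C * ((k : ℝ) ^ 2 /
                Real.cosh (surfDist Γ (proj Γ z) (proj Γ w) / 2) ^ (3 * k - 8)) := by
  have := countable_of_discreteTopology Γ
  obtain ⟨C, hC⟩ := theorem1_general Γ (n := 8) (by norm_num)
  exact ⟨C, fun F hF k hk => hC F hF k (by omega)⟩
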